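/- Let $\omega_1,\omega_2\in\mathbb C^*$ with $\operatorname{Im}(\omega_2/\omega_1)>0$, let $\Lambda=\mathbb Z\omega_1+\mathbb Z\omega_2$ and $\Lambda^*=\Lambda\setminus\{0\}$. For even $n\ge 4$ put $G_n=\sum_{\omega\in\Lambda^*}\omega^{-n}$, and $$G_2=\sum_{a_1\neq 0}\frac1{(a_1\omega_1)^2}+\sum_{a_2\ne 0}\sum_{a_1\in\mathbb Z}\frac1{(a_1\omega_1+a_2\omega_2)^2}.$$ Let $\sigma(u)=u\prod_{\omega\in\Lambda^*}(1-\tfrac u\omega)e^{u/\omega+u^2/(2\omega^2)}$ be the Weierstrass sigma function, and let $\mathscr h(u)=\log\sigma(u)-\log u-\tfrac12G_2u^2$, a many-valued function whose first derivatives in $u,\omega_1,\omega_2$ are single-valued meromorphic functions of $u$. Define $$\mathscr f(u)=2\,\partial_u\mathscr h(u)+u\,\partial_u^2\mathscr h(u),\qquad \mathscr k_i(u)=\partial_{\omega_i}\mathscr h(u)\quad(i=1,2).$$ Consider the formal power series $$H(\epsilon)=\sum_{g\ge2}\frac{B_{2g}\,G_{2g-2}\,(2\pi \mathrm i)^{2g}\,\epsilon^{2g-1}}{4g(2g-1)(2g-2)},\qquad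 F=\partial_\epsilon H,\qquad K_i=\partial_{\omega_i}H,$$ where $B_{2g}$ are the Bernoulli numbers, and let $f$ and $k_i$ be the Borel transforms of $F$ and $K_i$, the Borel transform of $\sum_{j\ge1}a_j\epsilon^j$ being $\sum_{j\ge1}a_j\eta^{j-1}/(j-1)!$. (i) The power series $f(\eta)$ and $k_i(\eta)$ have positive radius of convergence. (ii) They extend to meromorphic functions on $\mathbb C$, holomorphic outside $\Lambda^*$. The function $f$ has a double pole at each point of $\Lambda^*$. The function $k_i$ has a simple pole at each $a_1\omega_1+a_2\omega_2\in\Lambda^*$ with $a_i\neq0$, and is holomorphic at those with $a_i=0$ (so each point of $\Lambda^*$ is a simple pole of $k_1$ or of $k_2$). (iii) At all points that are not poles of the left-hand side, $$f(\eta)=\sum_{m\ge1}\frac1{m^3}\,\mathscr f\Big(\frac\eta m\Big),\qquad k_i(\eta)=\sum_{m\ge1}\frac1{m^2}\,\mathscr k_i\Big(\frac\eta m\Big).$$ Both series converge absolutely and uniformly on compact subsets of $\mathbb C$, as series of meromorphic functions: for each compact set, all but finitely many terms are holomorphic near it, and the series of these terms converges absolutely and uniformly on it. -/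

import Mathlib

noncomputable section

namespace EllipticBorel

/-- Pairs `(ω₁, ω₂)` (written `(ω 0, ω 1)`) of nonzero complex numbers with `Im (ω₂ / ω₁) > 0`. -/
def periodRegion : Set (Fin 2 → ℂ) :=
  {ω | ω 0 ≠ 0 ∧ ω 1 ≠ 0 ∧ 0 < (ω 1 / ω 0).im}

/-- The lattice point `a₁ ω₁ + a₂ ω₂`. -/
def latticePoint (ω : Fin 2 → ℂ) (a : Fin 2 → ℤ) : ℂ := a 0 * ω 0 + a 1 * ω 1

/-- The set `Λ*` of nonzero lattice points. -/
def puncturedLattice (ω : Fin 2 → ℂ) : Set ℂ := {z | ∃ a, a ≠ 0 ∧ z = latticePoint ω a}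

/-- The lattice points `a₁ ω₁ + a₂ ω₂` with `aᵢ ≠ 0`. -/
def latticePart (ω : Fin 2 → ℂ) (i : Fin 2) : Set ℂ := {z | ∃ a, a i ≠ 0 ∧ z = latticePoint ω a}

/-- `G₂` by Eisenstein summation. -/
def eisensteinG2 (ω : Fin 2 → ℂ) : ℂ :=
  (∑' a₁ : {n : ℤ // n ≠ 0}, 1 / ((a₁ : ℤ) * ω 0) ^ 2) +
    ∑' a₂ : {n : ℤ // n ≠ 0}, ∑' a₁ : ℤ, 1 / (a₁ * ω 0 + (a₂ : ℤ) * ω 1) ^ 2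

/-- The Eisenstein series `Gₙ`, used for even `n ≥ 2`. -/
def eisensteinG (n : ℕ) (ω : Fin 2 → ℂ) : ℂ :=
  if n = 2 then eisensteinG2 ω
  else ∑' a : {a : Fin 2 → ℤ // a ≠ 0}, 1 / latticePoint ω a ^ n

/-- The partial derivative `∂Φ / ∂ωᵢ`. -/
def partialω (i : Fin 2) (Φ : (Fin 2 → ℂ) → ℂ) (ω : Fin 2 → ℂ) : ℂ :=
  deriv (fun w => Φ (Function.update ω i w)) (ω i)

/-! ### The formal series and their Borel transforms -/

/-- The coefficient of `ε ^ (2g - 1)` in `H`, for `g ≥ 2`. -/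
def coeffH (g : ℕ) (ω : Fin 2 → ℂ) : ℂ :=
  (bernoulli (2 * g) : ℂ) * eisensteinG (2 * g - 2) ω * (2 * Real.pi * Complex.I) ^ (2 * g) /
    (4 * g * (2 * g - 1) * (2 * g - 2))

/-- `H(ε) = ∑_{g ≥ 2} coeffH g ω * ε ^ (2g - 1)`. -/
def seriesH (ω : Fin 2 → ℂ) : PowerSeries ℂ :=
  PowerSeries.mk fun k => if Odd k ∧ 3 ≤ k then coeffH ((k + 1) / 2) ω else 0

/-- `F = ∂H / ∂ε`. -/
def seriesF (ω : Fin 2 → ℂ) : PowerSeries ℂ := PowerSeries.derivative ℂ (seriesH ω)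

/-- `Kᵢ = ∂H / ∂ωᵢ`, coefficient by coefficient. -/
def seriesK (i : Fin 2) (ω : Fin 2 → ℂ) : PowerSeries ℂ :=
  PowerSeries.mk fun k => partialω i (fun ω' => PowerSeries.coeff k (seriesH ω')) ω

/-- The Borel transform `∑_{i ≥ 1} aᵢ ε ^ i ↦ ∑_{i ≥ 1} aᵢ η ^ (i - 1) / (i - 1)!`, as a power
series around the origin of `ℂ`. -/
def borelTransform (P : PowerSeries ℂ) : FormalMultilinearSeries ℂ ℂ ℂ :=
  FormalMultilinearSeries.ofScalars ℂ fun n => PowerSeries.coeff (n + 1) P / (n.factorial : ℂ)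

/-! ### The modified elliptic functions

The function `log σ(u) - log u - G₂ u² / 2` is many-valued, but its exponential `expH` is a
single-valued entire function of `u`, with value `1` at `u = 0`, and the first derivatives of the
former are the logarithmic derivatives of the latter. -/

/-- `σ(u) / u`, by the Weierstrass product. -/
def sigmaDivId (ω : Fin 2 → ℂ) (u : ℂ) : ℂ :=
  ∏' a : {a : Fin 2 → ℤ // a ≠ 0}, (1 - u / latticePoint ω a) *
    Complex.exp (u / latticePoint ω a + u ^ 2 / (2 * latticePoint ω a ^ 2))

/-- `exp (log σ(u) - log u - G₂ u² / 2)`. -/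
def expH (ω : Fin 2 → ℂ) (u : ℂ) : ℂ :=
  sigmaDivId ω u * Complex.exp (-(1 / 2) * eisensteinG2 ω * u ^ 2)

/-- The modified zeta function: the `u`-derivative of `log σ(u) - log u - G₂ u² / 2`. -/
def zetaTilde (ω : Fin 2 → ℂ) (u : ℂ) : ℂ := logDeriv (expH ω) u

/-- The modified `℘`-function: minus the second `u`-derivative of
`log σ(u) - log u - G₂ u² / 2`. -/
def wpTilde (ω : Fin 2 → ℂ) (u : ℂ) : ℂ := -deriv (zetaTilde ω) u

/-- The function `𝒻(u) = 2 ζ̃(u) - u ℘̃(u)`. -/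
def curlyF (ω : Fin 2 → ℂ) (u : ℂ) : ℂ := 2 * zetaTilde ω u - u * wpTilde ω u

/-- The function `𝓀ᵢ(u)`, the `ωᵢ`-derivative of `log σ(u) - log u - G₂ u² / 2`, as a meromorphic
function of `u` with its removable singularities filled in. -/
def curlyK (i : Fin 2) (ω : Fin 2 → ℂ) : ℂ → ℂ :=
  toMeromorphicNFOn (fun u => partialω i (fun ω' => expH ω' u) ω / expH ω u) Set.univ

/-! ### Meromorphic functions with prescribed poles, and series of meromorphic functions -/

/-- `g` is meromorphic on `ℂ`, with a pole of order exactly `n` at each point of `P`, and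
holomorphic at all the other points. -/
def MeromorphicWithPoles (g : ℂ → ℂ) (n : ℕ) (P : Set ℂ) : Prop :=
  Meromorphic g ∧ (∀ z ∈ P, meromorphicOrderAt g z = ((-(n : ℤ) : ℤ) : WithTop ℤ)) ∧
    ∀ z ∉ P, AnalyticAt ℂ g z

/-- Absolute and uniform convergence on compact subsets of `ℂ` of a series `∑_{m ≥ 1} t m` of
meromorphic functions: for each compact `K`, all but finitely many terms are holomorphic on a
neighbourhood of `K`, and the series of these terms converges absolutely and uniformly on `K`. -/
def ConvergesOnCompacts (t : ℕ → ℂ → ℂ) : Prop :=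
  (∀ m, 1 ≤ m → Meromorphic (t m)) ∧
  ∀ K : Set ℂ, IsCompact K → ∃ M : ℕ, 1 ≤ M ∧
    (∀ m, M ≤ m → AnalyticOnNhd ℂ (t m) K) ∧
    SummableUniformlyOn (fun (m : ℕ) η => ‖t (m + M) η‖) K ∧
    SummableUniformlyOn (fun (m : ℕ) η => t (m + M) η) K

end EllipticBorel

end

open Filter Topology Metric

namespace EllipticBorel

/-! ### Bounds on lattice points -/

/-! Two computations of Taylor coefficients at the origin meet. By Euler's formula, `B_{2g}
(2πi)^{2g} / (2 (2g)!)` equals `-ζ(2g)`. The denominators of `H`, combined with the factorials of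
the Borel transform, supply the rest, so each Borel coefficient has the form `γₙ ζ(n + N + 1)`, with
`N = 2` for `f` and `N = 1` for `kᵢ`. Here `γₙ` is the `n`-th Taylor coefficient of `c = 𝒻` or `c =
𝓀ᵢ`. Writing zeta as a sum over `m` and interchanging the sums near the origin gives `∑ m^{-(N+1)}
c(η/m)` (`hasSum_taylor_dilations`).

The coefficients `γₙ` come from logarithmic differentiation of the Weierstrass product, in `u` and
in `ωᵢ`. With `λ` running over `Λ*`, the results are `ζ̃ = u² ∑ 1/(λ²(u - λ)) - G₂ u` and `𝓀ᵢ = -u³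
∑ aᵢ/(λ³(u - λ)) - ½ (∂G₂/∂ωᵢ) u²` (`zetaTilde_eq`, `partialω_expH_div`). These absolutely
convergent series of simple fractions display both the Taylor coefficients and the polar parts. The
delicate ingredient is the differentiability of the conditionally convergent `G₂` in the periods:
subtracting a telescoping series makes it an absolutely convergent sum (`eisensteinG2_eq`).

The global statements use only that `c` is analytic at 0 and has poles of order `N` on a set `P`
stable under multiplication by positive integers. On a compact set all but finitely many dilations
stay near 0, where `c` is bounded, so the series converges. At `z ∈ P` the leading polar coefficient
of `c` is homogeneous of degree one (`-z` for `𝒻`, `-aᵢ` for `𝓀ᵢ`). Hence the `m`-th dilation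
contributes either nothing or that coefficient divided by `m²`. The contributions are positive
multiples of one another and cannot cancel, so the order of the pole is exactly `N`
(`meromorphicWithPoles_dilations`). -/

lemma latticePoint_sub_le (ω ω' : Fin 2 → ℂ) (a : Fin 2 → ℤ) :
    ‖latticePoint ω' a - latticePoint ω a‖ ≤ 2 * ‖a‖ * ‖ω' - ω‖ := by
  have h : latticePoint ω' a - latticePoint ω a
      = (a 0 : ℂ) * (ω' - ω) 0 + (a 1 : ℂ) * (ω' - ω) 1 := by
    simp only [latticePoint, Pi.sub_apply]; ring
  have hterm (j : Fin 2) : ‖(a j : ℂ) * (ω' - ω) j‖ ≤ ‖a‖ * ‖ω' - ω‖ := by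
    rw [norm_mul]
    refine mul_le_mul ?_ (norm_le_pi_norm _ j) (norm_nonneg _) (norm_nonneg _)
    simpa [Complex.norm_intCast, Int.norm_eq_abs] using norm_le_pi_norm a j
  rw [h]
  linarith [norm_add_le ((a 0 : ℂ) * (ω' - ω) 0) ((a 1 : ℂ) * (ω' - ω) 1), hterm 0, hterm 1]

lemma exists_mul_norm_le_norm_latticePoint {ω : Fin 2 → ℂ} (hω : ω ∈ periodRegion) :
    ∃ c > 0, ∀ a : Fin 2 → ℤ, c * ‖a‖ ≤ ‖latticePoint ω a‖ := by
  obtain ⟨h0, h1, him⟩ := hω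
  let z : UpperHalfPlane := ⟨ω 1 / ω 0, him⟩
  refine ⟨EisensteinSeries.r z * ‖ω 0‖,
    mul_pos (EisensteinSeries.r_pos z) (norm_pos_iff.2 h0), fun a => ?_⟩
  rcases eq_or_ne a 0 with rfl | ha
  · simp
  -- The coordinates are swapped because the bound for Eisenstein series concerns `b 0 * z + b 1`,
  -- whereas `ω₁` is factored out here with `z = ω₂ / ω₁`.
  have hb : (![a 1, a 0] : Fin 2 → ℤ) ≠ 0 := by
    intro h
    apply ha
    ext j
    fin_cases j
    · simpa using congrFun h 1
    · simpa using congrFun h 0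
  have key := EisensteinSeries.r_mul_max_le z hb
  have hn : ‖(![a 1, a 0] : Fin 2 → ℤ)‖ = ‖a‖ := by
    simp [EisensteinSeries.norm_eq_max_natAbs, max_comm]
  have hz : (z : ℂ) = ω 1 / ω 0 := rfl
  have he : latticePoint ω a = ((a 1 : ℂ) * z + a 0) * ω 0 := by
    rw [hz, latticePoint]; field_simp; ring
  rw [hn] at key
  rw [he, norm_mul]
  simp only [Matrix.cons_val_zero, Matrix.cons_val_one] at key
  nlinarith [norm_nonneg (ω 0)]

lemma eventually_mem_periodRegion {ω : Fin 2 → ℂ} (hω : ω ∈ periodRegion) :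
    ∀ᶠ ω' in 𝓝 ω, ω' ∈ periodRegion := by
  obtain ⟨h0, h1, him⟩ := hω
  have c0 : ContinuousAt (fun ω' : Fin 2 → ℂ => ω' 0) ω := (continuous_apply 0).continuousAt
  have c1 : ContinuousAt (fun ω' : Fin 2 → ℂ => ω' 1) ω := (continuous_apply 1).continuousAt
  have c2 : ContinuousAt (fun ω' : Fin 2 → ℂ => (ω' 1 / ω' 0).im) ω :=
    Complex.continuous_im.continuousAt.comp (c1.div c0 h0)
  filter_upwards [c0.eventually_ne h0, c1.eventually_ne h1,
    c2.eventually (lt_mem_nhds him)] with ω' h h' h'' using ⟨h, h', h''⟩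

/-- The lower bound for lattice points is uniform for nearby periods. -/
lemma exists_uniform_mul_norm_le {ω : Fin 2 → ℂ} (hω : ω ∈ periodRegion) :
    ∃ c > 0, ∃ ε > 0, ∀ ω', ‖ω' - ω‖ < ε → ω' ∈ periodRegion ∧
      ∀ a : Fin 2 → ℤ, c * ‖a‖ ≤ ‖latticePoint ω' a‖ := by
  obtain ⟨c, hc, hb⟩ := exists_mul_norm_le_norm_latticePoint hω
  obtain ⟨δ, hδ, hball⟩ := Metric.eventually_nhds_iff.1 (eventually_mem_periodRegion hω)
  -- Moving the periods by at most `c / 4` moves a lattice point by at most `2 * ‖a‖ * (c / 4)`,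
  -- half of the lower bound `c * ‖a‖`.
  refine ⟨c / 2, by positivity, min δ (c / 4), by positivity, fun ω' h => ⟨?_, fun a => ?_⟩⟩
  · exact hball (by rw [dist_eq_norm]; exact h.trans_le (min_le_left _ _))
  · have h1 := latticePoint_sub_le ω ω' a
    have h2 : ‖ω' - ω‖ ≤ c / 4 := (h.trans_le (min_le_right _ _)).le
    have h3 : ‖latticePoint ω a‖ ≤ ‖latticePoint ω' a‖ +
        ‖latticePoint ω' a - latticePoint ω a‖ := by
      have := norm_sub_le (latticePoint ω' a) (latticePoint ω' a - latticePoint ω a)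
      simpa using this
    nlinarith [hb a, norm_nonneg a]

lemma norm_update_sub (ω : Fin 2 → ℂ) (i : Fin 2) (w : ℂ) :
    ‖Function.update ω i w - ω‖ ≤ ‖w - ω i‖ := by
  refine (pi_norm_le_iff_of_nonneg (norm_nonneg _)).2 fun j => ?_
  rcases eq_or_ne j i with rfl | h
  · simp
  · simp [Function.update_of_ne h]

lemma latticePoint_update (ω : Fin 2 → ℂ) (i : Fin 2) (w : ℂ) (a : Fin 2 → ℤ) :
    latticePoint (Function.update ω i w) a = latticePoint ω a + a i * (w - ω i) := by
  fin_cases i <;> simp [latticePoint] <;> ring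

lemma one_le_norm_of_ne_zero {a : Fin 2 → ℤ} (ha : a ≠ 0) : 1 ≤ ‖a‖ := by
  obtain ⟨j, hj⟩ := Function.ne_iff.1 ha
  refine le_trans ?_ (norm_le_pi_norm a j)
  rw [Int.norm_eq_abs]
  exact_mod_cast Int.one_le_abs hj

lemma latticePoint_ne_zero {ω : Fin 2 → ℂ} {c : ℝ} (hc : 0 < c)
    (hb : ∀ a : Fin 2 → ℤ, c * ‖a‖ ≤ ‖latticePoint ω a‖) {a : Fin 2 → ℤ} (ha : a ≠ 0) :
    latticePoint ω a ≠ 0 := by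
  rw [← norm_pos_iff]
  have := one_le_norm_of_ne_zero ha
  nlinarith [hb a]

lemma latticePoint_injective {ω : Fin 2 → ℂ} (hω : ω ∈ periodRegion) :
    Function.Injective (latticePoint ω) := by
  obtain ⟨c, hc, hb⟩ := exists_mul_norm_le_norm_latticePoint hω
  intro a b hab
  by_contra hne
  apply latticePoint_ne_zero hc hb (sub_ne_zero.2 hne)
  have : latticePoint ω (a - b) = latticePoint ω a - latticePoint ω b := by
    simp [latticePoint]; ring
  rw [this, hab, sub_self]

lemma finite_norm_latticePoint_le {ω : Fin 2 → ℂ} (hω : ω ∈ periodRegion) (R : ℝ) :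
    {a : {a : Fin 2 → ℤ // a ≠ 0} | ‖latticePoint ω a‖ ≤ R}.Finite := by
  obtain ⟨c, hc, hb⟩ := exists_mul_norm_le_norm_latticePoint hω
  have hf : (Metric.closedBall (0 : Fin 2 → ℤ) (R / c)).Finite :=
    (isCompact_closedBall _ _).finite_of_discrete
  refine (hf.preimage Subtype.val_injective.injOn).subset fun a ha => ?_
  simp only [Set.mem_preimage, mem_closedBall, dist_zero_right]
  rw [le_div_iff₀ hc, mul_comm]
  exact (hb a).trans ha

lemma summable_inv_norm_pow {k : ℕ} (hk : 3 ≤ k) :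
    Summable fun a : {a : Fin 2 → ℤ // a ≠ 0} => (‖a.1‖ ^ k)⁻¹ := by
  have h : (2 : ℝ) < k := by exact_mod_cast hk
  refine ((EisensteinSeries.summable_one_div_norm_rpow h).subtype {a | a ≠ 0}).congr fun a => ?_
  simp [Real.rpow_neg]

lemma inv_norm_latticePoint_pow_le {ω : Fin 2 → ℂ} {c : ℝ} (hc : 0 < c)
    (hb : ∀ a : Fin 2 → ℤ, c * ‖a‖ ≤ ‖latticePoint ω a‖) {a : Fin 2 → ℤ} (ha : a ≠ 0) (k : ℕ) :
    (‖latticePoint ω a‖ ^ k)⁻¹ ≤ (c ^ k)⁻¹ * (‖a‖ ^ k)⁻¹ := by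
  have := one_le_norm_of_ne_zero ha
  rw [← mul_inv, ← mul_pow]
  exact inv_anti₀ (by positivity) (pow_le_pow_left₀ (by positivity) (hb a) k)

lemma summable_inv_norm_latticePoint_pow {ω : Fin 2 → ℂ} (hω : ω ∈ periodRegion) {k : ℕ}
    (hk : 3 ≤ k) :
    Summable fun a : {a : Fin 2 → ℤ // a ≠ 0} => (‖latticePoint ω a‖ ^ k)⁻¹ := by
  obtain ⟨c, hc, hb⟩ := exists_mul_norm_le_norm_latticePoint hω
  exact Summable.of_nonneg_of_le (fun _ => by positivity)
    (fun a => inv_norm_latticePoint_pow_le hc hb a.2 k)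
    ((summable_inv_norm_pow hk).mul_left _)

/-- Interchange of summations. -/
lemma hasSum_comm_of_summable {J K : Type*} {F : J × K → ℂ} (hF : Summable F)
    {r : J → ℂ} {c : K → ℂ} (hr : ∀ j, HasSum (fun k => F (j, k)) (r j))
    (hc : ∀ k, ∑' j, F (j, k) = c k) : HasSum c (∑' j, r j) := by
  rw [(hF.hasSum.prod_fiberwise hr).tsum_eq]
  have h := hF.prod_symm
  have h' := h.hasSum.prod_fiberwise fun k => (h.prod_factor k).hasSum
  simp only [Prod.swap_prod_mk, hc] at h'
  exact (Equiv.prodComm K J).tsum_eq F ▸ h'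

/-! ### Series of simple fractions -/

section SimpleFractions

variable {J : Type*} {lam α : J → ℂ}

lemma norm_div_sub_le {u l a : ℂ} {R : ℝ} (hu : ‖u‖ ≤ R) (hl : 2 * R < ‖l‖) :
    ‖a / (u - l)‖ ≤ 2 * (‖a‖ / ‖l‖) := by
  have hl0 : 0 < ‖l‖ := by linarith [norm_nonneg u]
  have h : ‖l‖ / 2 ≤ ‖u - l‖ := by
    rw [norm_sub_rev]; linarith [norm_sub_norm_le l u]
  rw [norm_div]
  calc ‖a‖ / ‖u - l‖ ≤ ‖a‖ / (‖l‖ / 2) := by gcongr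
    _ = 2 * (‖a‖ / ‖l‖) := by field_simp

/-- Only finitely many poles lie within `2 * ‖u‖`, and the other terms are dominated. No condition
on `u` is needed, since a term at its own pole is 0 by the convention `x / 0 = 0`. -/
lemma summable_simpleFractions (hfin : ∀ R : ℝ, {j | ‖lam j‖ ≤ R}.Finite)
    (hα : Summable fun j => ‖α j‖ / ‖lam j‖) (u : ℂ) :
    Summable fun j => α j / (u - lam j) := by
  refine (hα.mul_left 2).of_norm_bounded_eventually ?_
  filter_upwards [(hfin (2 * ‖u‖)).compl_mem_cofinite] with j hj
  exact norm_div_sub_le le_rfl (by simpa using hj)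

/-- A series of simple fractions is analytic where no term has a pole. -/
lemma analyticAt_simpleFractions (hfin : ∀ R : ℝ, {j | ‖lam j‖ ≤ R}.Finite)
    (hα : Summable fun j => ‖α j‖ / ‖lam j‖) {z : ℂ} (hz : ∀ j, lam j = z → α j = 0) :
    AnalyticAt ℂ (fun u => ∑' j, α j / (u - lam j)) z := by
  set R := ‖z‖ + 1
  set s := (hfin (2 * R)).toFinset
  have hsplit : (fun u => ∑' j, α j / (u - lam j)) =
      fun u => ∑ j ∈ s, α j / (u - lam j) + ∑' j : {j // j ∉ s}, α j / (u - lam j) := by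
    funext u
    exact ((summable_simpleFractions hfin hα u).sum_add_tsum_subtype_compl s).symm
  rw [hsplit]
  refine AnalyticAt.add ?_ ?_
  · refine Finset.analyticAt_fun_sum _ fun j _ => ?_
    by_cases hj : lam j = z
    · simp only [hz j hj, zero_div]
      exact analyticAt_const
    · exact analyticAt_const.div (by fun_prop) (sub_ne_zero.2 (Ne.symm hj))
  · have hd : DifferentiableOn ℂ (fun u => ∑' j : {j // j ∉ s}, α j / (u - lam j)) (ball 0 R) := by
      refine Complex.differentiableOn_tsum_of_summable_norm
        (u := fun j : {j // j ∉ s} => 2 * (‖α j‖ / ‖lam j‖))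
        ((hα.mul_left 2).subtype _) (fun j u hu => ?_) isOpen_ball fun j u hu => ?_
      · have hj : 2 * R < ‖lam j‖ := by simpa [s] using j.2
        have hu' : ‖u‖ < R := by simpa using hu
        have hne : u - lam j ≠ 0 := by
          intro h
          rw [sub_eq_zero.1 h] at hu'
          linarith [norm_nonneg (lam j)]
        have hd : DifferentiableAt ℂ (fun u => u - lam j) u := by fun_prop
        exact ((differentiableAt_const _).fun_div hd hne).differentiableWithinAt
      · exact norm_div_sub_le (by simpa using (mem_ball.1 hu).le) (by simpa [s] using j.2)
    exact hd.analyticAt (isOpen_ball.mem_nhds (by simp [R]))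

/-- The principal part of a series of simple fractions. -/
lemma exists_analyticAt_simpleFractions (hinj : Function.Injective lam)
    (hfin : ∀ R : ℝ, {j | ‖lam j‖ ≤ R}.Finite)
    (hα : Summable fun j => ‖α j‖ / ‖lam j‖) (j₀ : J) :
    ∃ g : ℂ → ℂ, AnalyticAt ℂ g (lam j₀) ∧
      ∀ u, ∑' j, α j / (u - lam j) = α j₀ / (u - lam j₀) + g u := by
  classical
  -- Replacing the numerator at `j₀` by zero keeps the series in the same form, and injectivity
  -- ensures that no other term has a pole at `lam j₀`.
  refine ⟨fun u => ∑' j, (if j = j₀ then 0 else α j) / (u - lam j), ?_, fun u => ?_⟩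
  · refine analyticAt_simpleFractions hfin
      (hα.of_nonneg_of_le (fun _ => by positivity) fun j => ?_) fun j hj => ?_
    · split_ifs
      · simp; positivity
      · exact le_rfl
    · simp [hinj hj]
  · rw [(summable_simpleFractions hfin hα u).tsum_eq_add_tsum_ite j₀]
    congr 1
    refine tsum_congr fun j => ?_
    split_ifs <;> simp

/-- The Taylor expansion at the origin of a series of simple fractions. -/
lemma hasSum_taylor_simpleFractions {r : ℝ} (hr : ∀ j, r ≤ ‖lam j‖)
    (hα : Summable fun j => ‖α j‖ / ‖lam j‖) {u : ℂ} (hu : ‖u‖ < r) :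
    HasSum (fun n : ℕ => -(∑' j, α j / lam j ^ (n + 1)) * u ^ n) (∑' j, α j / (u - lam j)) := by
  have hr0 : 0 < r := (norm_nonneg u).trans_lt hu
  have hq : ‖u‖ / r < 1 := (div_lt_one hr0).2 hu
  let F : J × ℕ → ℂ := fun p => -(α p.1 / lam p.1 ^ (p.2 + 1)) * u ^ p.2
  have hF : Summable F := by
    -- The double series is dominated by the product of `∑ ‖α j‖ / ‖lam j‖` with a geometric series
    -- of ratio `‖u‖ / r`.
    refine Summable.of_norm_bounded (hα.mul_of_nonneg
      (summable_geometric_of_lt_one (by positivity) hq) (fun _ => by positivity)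
      fun _ => by positivity) fun p => ?_
    have hl : 0 < ‖lam p.1‖ := hr0.trans_le (hr _)
    have h1 : ‖F p‖ = ‖α p.1‖ / ‖lam p.1‖ * (‖u‖ / ‖lam p.1‖) ^ p.2 := by
      simp only [F, norm_mul, norm_neg, norm_div, norm_pow, div_pow, pow_succ]
      field_simp
    rw [h1]
    have := hr p.1
    gcongr
  have hrow (j : J) : HasSum (fun n => F (j, n)) (α j / (u - lam j)) := by
    have hl : 0 < ‖lam j‖ := hr0.trans_le (hr _)
    have hl0 : lam j ≠ 0 := norm_pos_iff.1 hl
    have hne : u - lam j ≠ 0 := by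
      intro h
      rw [sub_eq_zero.1 h] at hu
      linarith [hr j]
    have hlt : ‖u / lam j‖ < 1 := by
      rw [norm_div, div_lt_one hl]; exact hu.trans_le (hr j)
    have hne' : 1 - u / lam j ≠ 0 := by
      intro h
      have : u / lam j = 1 := (sub_eq_zero.1 h).symm
      simp [this] at hlt
    convert! (hasSum_geometric_of_norm_lt_one hlt).mul_left (-(α j / lam j)) using 1
    · funext n
      simp only [F, div_pow, pow_succ]
      field_simp
    · rw [show 1 - u / lam j = -((u - lam j) / lam j) by field_simp; ring, inv_neg, inv_div]
      field_simp
  refine hasSum_comm_of_summable hF hrow fun n => ?_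
  simp only [F, tsum_mul_right, tsum_neg]

end SimpleFractions

/-! ### Weierstrass factors of genus two -/

/-- The Weierstrass elementary factor `(1 - x) exp (x + x² / 2)`. -/
noncomputable def elementaryFactor (x : ℂ) : ℂ := (1 - x) * Complex.exp (x + x ^ 2 / 2)

/-- The terms cancel through `(1 - x)(1 + x) - 1 = -x²`. This double zero of the derivative makes
the factor agree with 1 to third order, which matches the convergence of `∑ |λ|⁻³`. -/
lemma hasDerivAt_elementaryFactor (x : ℂ) :
    HasDerivAt elementaryFactor (-x ^ 2 * Complex.exp (x + x ^ 2 / 2)) x := by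
  have h1 : HasDerivAt (fun x : ℂ => 1 - x) (-1) x := by
    simpa using (hasDerivAt_id x).const_sub 1
  have h2 : HasDerivAt (fun x : ℂ => x + x ^ 2 / 2) (1 + x) x := by
    convert! (hasDerivAt_id x).add (((hasDerivAt_id x).pow 2).div_const 2) using 1
    simp
  convert! h1.mul h2.cexp using 1
  ring

lemma differentiable_elementaryFactor : Differentiable ℂ elementaryFactor :=
  fun x => (hasDerivAt_elementaryFactor x).differentiableAt

lemma elementaryFactor_ne_zero {x : ℂ} (hx : x ≠ 1) : elementaryFactor x ≠ 0 :=
  mul_ne_zero (sub_ne_zero.2 hx.symm) (Complex.exp_ne_zero _)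

/-- The inner function is arbitrary so that one formula serves for differentiation both in `u` and
in a period. -/
lemma logDeriv_elementaryFactor_comp {x : ℂ → ℂ} {w : ℂ} (hx : DifferentiableAt ℂ x w)
    (h1 : x w ≠ 1) :
    logDeriv (fun w => elementaryFactor (x w)) w = -(deriv x w * x w ^ 2 / (1 - x w)) := by
  have h := ((hasDerivAt_elementaryFactor (x w)).comp w hx.hasDerivAt).deriv
  have h1' : 1 - x w ≠ 0 := sub_ne_zero.2 h1.symm
  rw [logDeriv_apply]
  change deriv (elementaryFactor ∘ x) w / _ = _
  rw [h, elementaryFactor]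
  field_simp [Complex.exp_ne_zero]

lemma norm_elementaryFactor_sub_one_le (B : ℝ) :
    ∃ C, 0 ≤ C ∧ ∀ x : ℂ, ‖x‖ ≤ B → ‖elementaryFactor x - 1‖ ≤ C * ‖x‖ ^ 3 := by
  refine ⟨Real.exp (B + B ^ 2 / 2), by positivity, fun x hx => ?_⟩
  have key := (convex_closedBall (0 : ℂ) ‖x‖).norm_image_sub_le_of_norm_hasDerivWithin_le
    (f := elementaryFactor) (C := Real.exp (B + B ^ 2 / 2) * ‖x‖ ^ 2) (x := 0) (y := x)
    (fun y _ => (hasDerivAt_elementaryFactor y).hasDerivWithinAt) (fun y hy => ?_)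
    (by simp) (by simp)
  · simpa [elementaryFactor, mul_assoc, pow_succ] using key
  · have hy' : ‖y‖ ≤ ‖x‖ := by simpa using hy
    rw [norm_mul, norm_neg, norm_pow, mul_comm]
    gcongr
    rw [Complex.norm_exp]
    refine Real.exp_le_exp.2 ((Complex.re_le_norm _).trans ?_)
    refine (norm_add_le _ _).trans ?_
    have : ‖y ^ 2 / 2‖ = ‖y‖ ^ 2 / 2 := by simp
    rw [this]
    have := hy'.trans hx
    gcongr

/-- A product of elementary factors is holomorphic, vanishes only where a factor does, and can be
differentiated logarithmically term by term. -/
lemma logDeriv_tprod_elementaryFactor {ι : Type*} {U : Set ℂ} (hU : IsOpen U) {x : ι → ℂ → ℂ}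
    {b : ι → ℝ} (hb : Summable b) (hx : ∀ j, DifferentiableOn ℂ (x j) U)
    (hle : ∀ j, ∀ w ∈ U, ‖x j w‖ ^ 3 ≤ b j) {w : ℂ} (hw : w ∈ U) (h1 : ∀ j, x j w ≠ 1)
    (hs : Summable fun j => deriv (x j) w * x j w ^ 2 / (1 - x j w)) :
    DifferentiableAt ℂ (fun w => ∏' j, elementaryFactor (x j w)) w ∧
    ∏' j, elementaryFactor (x j w) ≠ 0 ∧
    logDeriv (fun w => ∏' j, elementaryFactor (x j w)) w =
      -∑' j, deriv (x j) w * x j w ^ 2 / (1 - x j w) := by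
  have hb0 (j : ι) : 0 ≤ b j := (by positivity : (0 : ℝ) ≤ ‖x j w‖ ^ 3).trans (hle j w hw)
  -- The constant in the cubic estimate needs a common bound on the `x j`: a value above 1 is at
  -- most its own cube, hence at most `∑ b`.
  have hB (j : ι) (v : ℂ) (hv : v ∈ U) : ‖x j v‖ ≤ 1 + ∑' j, b j := by
    have h := (hle j v hv).trans (hb.le_tsum j fun k _ => hb0 k)
    by_contra! hlt
    have h0 : 0 ≤ ∑' j, b j := tsum_nonneg hb0
    have h1 : 1 ≤ ‖x j v‖ := by linarith
    have : ‖x j v‖ ≤ ‖x j v‖ ^ 3 := le_self_pow₀ h1 (by norm_num)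
    linarith
  obtain ⟨C, hC, hbound⟩ := norm_elementaryFactor_sub_one_le (1 + ∑' j, b j)
  have hle' (j : ι) (v : ℂ) (hv : v ∈ U) : ‖elementaryFactor (x j v) - 1‖ ≤ C * b j :=
    (hbound _ (hB j v hv)).trans (mul_le_mul_of_nonneg_left (hle j v hv) hC)
  have hd (j : ι) : DifferentiableOn ℂ (fun w => elementaryFactor (x j w)) U :=
    fun v hv => (differentiable_elementaryFactor _).comp_differentiableWithinAt v (hx j v hv)
  have hprod := Summable.hasProdLocallyUniformlyOn_one_add (K := U) hU (hb.mul_left C)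
    (f := fun j w => elementaryFactor (x j w) - 1)
    (Eventually.of_forall fun j v hv => hle' j v hv)
    (fun j => (hd j).continuousOn.sub continuousOn_const)
  simp only [add_sub_cancel] at hprod
  have hdiff : DifferentiableOn ℂ (fun w => ∏' j, elementaryFactor (x j w)) U :=
    TendstoLocallyUniformlyOn.differentiableOn hprod
      (Eventually.of_forall fun s => DifferentiableOn.fun_finsetProd fun j _ => hd j) hU
  have hne : ∏' j, elementaryFactor (x j w) ≠ 0 := by
    have := tprod_one_add_ne_zero_of_summable (R := ℂ)
      (f := fun j => elementaryFactor (x j w) - 1)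
      (fun j => by simpa using elementaryFactor_ne_zero (h1 j))
      (Summable.of_nonneg_of_le (fun _ => norm_nonneg _) (fun j => hle' j w hw) (hb.mul_left C))
    simpa using this
  have hl (j : ι) := logDeriv_elementaryFactor_comp
    ((hx j).differentiableAt (hU.mem_nhds hw)) (h1 j)
  refine ⟨hdiff.differentiableAt (hU.mem_nhds hw), hne, ?_⟩
  rw [logDeriv_tprod_eq_tsum hU hw (f := fun j w => elementaryFactor (x j w))
    (fun j => elementaryFactor_ne_zero (h1 j)) hd
    (by simpa only [hl] using hs.neg) hprod.multipliableLocallyUniformlyOn hne, ← tsum_neg]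
  exact tsum_congr hl

/-! ### Holomorphic dependence of `G₂` on the periods -/

/-- The symmetric partial sums telescope to zero. Absolute convergence identifies this limit with
the unconditional sum. -/
lemma hasSum_telescoping_linear (z : UpperHalfPlane) (m : ℤ) :
    HasSum (fun n : ℤ => 1 / ((m : ℂ) * z + n) - 1 / (m * z + n + 1)) 0 := by
  have hs := EisensteinSeries.summable_right_one_div_linear_sub_one_div_linear_succ z m
  have h := EisensteinSeries.tsum_symmetricIco_linear_sub_linear_add_one_eq_zero z m
  rw [tsum_eq_of_summable_unconditional hs] at h
  exact h ▸ hs.hasSum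

/-- The inner sums of `G₂` as sums of terms of order three. -/
lemma tsum_inv_sq_eq {ω : Fin 2 → ℂ} (hω : ω ∈ periodRegion) {b : ℤ} (hb : b ≠ 0) :
    ∑' a : ℤ, 1 / ((a : ℂ) * ω 0 + b * ω 1) ^ 2 =
      ∑' a : ℤ, latticePoint ω ![1, 0] /
        (latticePoint ω ![a, b] ^ 2 * latticePoint ω ![a + 1, b]) := by
  obtain ⟨c, hc, hbd⟩ := exists_mul_norm_le_norm_latticePoint hω
  have hne (a : ℤ) : latticePoint ω ![a, b] ≠ 0 :=
    latticePoint_ne_zero hc hbd fun h => hb (by simpa using congrFun h 1)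
  obtain ⟨h0, h1, him⟩ := hω
  let z : UpperHalfPlane := ⟨ω 1 / ω 0, him⟩
  have hz : (z : ℂ) = ω 1 / ω 0 := rfl
  have hlam (a : ℤ) : latticePoint ω ![a, b] = ω 0 * (b * z + a) := by
    simp only [hz, latticePoint, Matrix.cons_val_zero, Matrix.cons_val_one]; field_simp; ring
  have hy (a : ℤ) : (b : ℂ) * z + a ≠ 0 := fun h => hne a (by rw [hlam, h, mul_zero])
  have hy' (a : ℤ) : (b : ℂ) * z + a + 1 ≠ 0 := by simpa [add_assoc] using hy (a + 1)
  have hs := (EisensteinSeries.linear_right_summable z b (k := 2) le_rfl).hasSum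
  have hL : ∑' a : ℤ, 1 / ((a : ℂ) * ω 0 + b * ω 1) ^ 2 =
      (ω 0 ^ 2)⁻¹ * ∑' a : ℤ, (((b : ℂ) * z + a) ^ (2 : ℤ))⁻¹ := by
    rw [← tsum_mul_left]
    refine tsum_congr fun a => ?_
    have : (a : ℂ) * ω 0 + b * ω 1 = ω 0 * (b * z + a) := by
      rw [← hlam]; simp [latticePoint]
    rw [this, mul_pow, one_div, mul_inv]
    norm_cast
  rw [hL]
  -- With `x = b z + a`, the identity is `1/x² - (1/x - 1/(x+1)) = 1/(x²(x+1))`; the subtracted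
  -- series has sum zero.
  have hR := ((hs.sub (hasSum_telescoping_linear z b)).mul_left (ω 0 ^ 2)⁻¹).tsum_eq
  rw [sub_zero] at hR
  rw [← hR]
  refine tsum_congr fun a => ?_
  rw [hlam, hlam]
  have h3 := hy a
  have h4 := hy' a
  simp only [latticePoint, Matrix.cons_val_zero, Matrix.cons_val_one, Int.cast_one, Int.cast_zero,
    Int.cast_add, zpow_ofNat, one_mul, zero_mul, add_zero, ← add_assoc]
  field_simp
  ring

lemma norm_vec_le_two_mul {a b : ℤ} (hb : b ≠ 0) :
    ‖(![a, b] : Fin 2 → ℤ)‖ ≤ 2 * ‖(![a + 1, b] : Fin 2 → ℤ)‖ := by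
  have h1 : ‖a + 1‖ ≤ ‖(![a + 1, b] : Fin 2 → ℤ)‖ := norm_le_pi_norm (![a + 1, b]) 0
  have h2 : ‖b‖ ≤ ‖(![a + 1, b] : Fin 2 → ℤ)‖ := norm_le_pi_norm (![a + 1, b]) 1
  have h3 : (1 : ℝ) ≤ ‖b‖ := by
    rw [Int.norm_eq_abs]; exact_mod_cast Int.one_le_abs hb
  have h4 : ‖a‖ ≤ ‖a + 1‖ + 1 := by simpa using norm_sub_le (a + 1) 1
  refine (pi_norm_le_iff_of_nonneg (by positivity)).2 fun j => ?_
  fin_cases j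
  · simp only [Fin.zero_eta, Matrix.cons_val_zero]; linarith
  · simp only [Fin.mk_one, Matrix.cons_val_one, Matrix.cons_val_fin_one]
    linarith [norm_nonneg b]

/-- The shift from `a` to `a + 1` costs a factor 2. The bound depends on the periods only through
`c` and `ω₁`, so it is locally uniform in them. -/
lemma norm_eisensteinG2_term_le {ω : Fin 2 → ℂ} {c : ℝ} (hc : 0 < c)
    (hbd : ∀ a : Fin 2 → ℤ, c * ‖a‖ ≤ ‖latticePoint ω a‖) {a b : ℤ} (hb : b ≠ 0) :
    ‖latticePoint ω ![1, 0] / (latticePoint ω ![a, b] ^ 2 * latticePoint ω ![a + 1, b])‖ ≤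
      ‖latticePoint ω ![1, 0]‖ * (2 * (c ^ 3)⁻¹) * (‖(![a, b] : Fin 2 → ℤ)‖ ^ 3)⁻¹ := by
  have hne (a : ℤ) : (![a, b] : Fin 2 → ℤ) ≠ 0 := fun h => hb (by simpa using congrFun h 1)
  have h1 := one_le_norm_of_ne_zero (hne a)
  have h2 : c * ‖(![a, b] : Fin 2 → ℤ)‖ / 2 ≤ ‖latticePoint ω ![a + 1, b]‖ := by
    have := hbd ![a + 1, b]
    nlinarith [norm_vec_le_two_mul (a := a) hb]
  rw [norm_div, norm_mul, norm_pow, div_eq_mul_inv, mul_assoc]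
  refine mul_le_mul_of_nonneg_left ?_ (norm_nonneg _)
  calc (‖latticePoint ω ![a, b]‖ ^ 2 * ‖latticePoint ω ![a + 1, b]‖)⁻¹
      ≤ ((c * ‖(![a, b] : Fin 2 → ℤ)‖) ^ 2 * (c * ‖(![a, b] : Fin 2 → ℤ)‖ / 2))⁻¹ := by
        refine inv_anti₀ (by positivity) ?_
        gcongr
        exact hbd _
    _ = 2 * (c ^ 3)⁻¹ * (‖(![a, b] : Fin 2 → ℤ)‖ ^ 3)⁻¹ := by field_simp

/-- The index of the lattice point `a ω₁ + b ω₂` with `b ≠ 0`. -/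
def vecOfNeZero (p : {n : ℤ // n ≠ 0} × ℤ) : {a : Fin 2 → ℤ // a ≠ 0} :=
  ⟨![p.2, p.1.1], fun h => p.1.2 (congrFun h 1)⟩

lemma vecOfNeZero_injective : Function.Injective vecOfNeZero := by
  intro p q h
  have h' : (![p.2, p.1.1] : Fin 2 → ℤ) = ![q.2, q.1.1] := congrArg Subtype.val h
  exact Prod.ext (Subtype.ext (congrFun h' 1)) (congrFun h' 0)

lemma summable_inv_norm_vec_pow_three :
    Summable fun p : {n : ℤ // n ≠ 0} × ℤ => (‖(![p.2, p.1.1] : Fin 2 → ℤ)‖ ^ 3)⁻¹ :=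
  ((summable_inv_norm_pow (k := 3) le_rfl).comp_injective vecOfNeZero_injective).congr
    fun _ => rfl

/-- The iterated sum becomes a single absolutely convergent sum over pairs, to which termwise
differentiation applies. Writing `ω₁` as `latticePoint ω ![1, 0]` lets its dependence on either
period be treated like that of any lattice point. -/
lemma eisensteinG2_eq {ω : Fin 2 → ℂ} (hω : ω ∈ periodRegion) :
    eisensteinG2 ω = (∑' n : {n : ℤ // n ≠ 0}, 1 / ((n : ℤ) : ℂ) ^ 2) / latticePoint ω ![1, 0] ^ 2 +
      ∑' p : {n : ℤ // n ≠ 0} × ℤ, latticePoint ω ![1, 0] /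
        (latticePoint ω ![p.2, p.1.1] ^ 2 * latticePoint ω ![p.2 + 1, p.1.1]) := by
  obtain ⟨c, hc, hbd⟩ := exists_mul_norm_le_norm_latticePoint hω
  have hs : Summable fun p : {n : ℤ // n ≠ 0} × ℤ => latticePoint ω ![1, 0] /
        (latticePoint ω ![p.2, p.1.1] ^ 2 * latticePoint ω ![p.2 + 1, p.1.1]) :=
    Summable.of_norm_bounded (summable_inv_norm_vec_pow_three.mul_left _)
      fun p => norm_eisensteinG2_term_le hc hbd p.1.2
  rw [hs.tsum_prod, eisensteinG2, ← tsum_div_const]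
  congr 1
  · refine tsum_congr fun n => ?_
    simp [latticePoint, mul_pow, div_eq_mul_inv, mul_comm]
  · exact tsum_congr fun n => tsum_inv_sq_eq hω n.2

lemma differentiable_latticePoint_update (ω : Fin 2 → ℂ) (i : Fin 2) (a : Fin 2 → ℤ) :
    Differentiable ℂ fun w => latticePoint (Function.update ω i w) a := by
  simp only [latticePoint_update]
  fun_prop

lemma differentiableAt_eisensteinG2_update {ω : Fin 2 → ℂ} (hω : ω ∈ periodRegion) (i : Fin 2) :
    DifferentiableAt ℂ (fun w => eisensteinG2 (Function.update ω i w)) (ω i) := by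
  obtain ⟨c, hc, ε, hε, h⟩ := exists_uniform_mul_norm_le hω
  have hU (w : ℂ) (hw : w ∈ ball (ω i) ε) : Function.update ω i w ∈ periodRegion ∧
      ∀ a : Fin 2 → ℤ, c * ‖a‖ ≤ ‖latticePoint (Function.update ω i w) a‖ :=
    h _ ((norm_update_sub ω i w).trans_lt (by simpa [dist_eq_norm] using hw))
  have hmem : ball (ω i) ε ∈ 𝓝 (ω i) := ball_mem_nhds _ hε
  have hne (w : ℂ) (hw : w ∈ ball (ω i) ε) (a : Fin 2 → ℤ) (ha : a ≠ 0) :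
      latticePoint (Function.update ω i w) a ≠ 0 := latticePoint_ne_zero hc (hU w hw).2 ha
  have hd (a : Fin 2 → ℤ) (w : ℂ) :=
    (differentiable_latticePoint_update ω i a w)
  have hv (a : ℤ) {b : ℤ} (hb : b ≠ 0) : (![a, b] : Fin 2 → ℤ) ≠ 0 :=
    fun h => hb (by simpa using congrFun h 1)
  have h10 : (![1, 0] : Fin 2 → ℤ) ≠ 0 := fun h => by simpa using congrFun h 0
  have hEq : (fun w => eisensteinG2 (Function.update ω i w)) =ᶠ[𝓝 (ω i)] _ :=
    Filter.eventuallyEq_of_mem hmem fun w hw => eisensteinG2_eq (hU w hw).1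
  refine DifferentiableAt.congr_of_eventuallyEq ?_ hEq
  refine DifferentiableAt.fun_add ?_ ?_
  · exact (differentiableAt_const _).fun_div ((hd _ _).fun_pow 2)
      (pow_ne_zero 2 (hne _ (mem_ball_self hε) _ h10))
  · refine (Complex.differentiableOn_tsum_of_summable_norm
      -- The factor `‖ω 0‖ + ε` bounds the first period throughout the disc, whichever period is
      -- varied.
      (summable_inv_norm_vec_pow_three.mul_left ((‖ω 0‖ + ε) * (2 * (c ^ 3)⁻¹)))
      (fun p w hw => ?_) isOpen_ball fun p w hw => ?_).differentiableAt hmem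
    · exact ((hd _ _).fun_div (((hd _ _).fun_pow 2).fun_mul (hd _ _))
        (mul_ne_zero (pow_ne_zero 2 (hne w hw _ (hv _ p.1.2)))
          (hne w hw _ (hv _ p.1.2)))).differentiableWithinAt
    · refine (norm_eisensteinG2_term_le hc (hU w hw).2 p.1.2).trans ?_
      gcongr
      have hw' : ‖w - ω i‖ < ε := by simpa [dist_eq_norm] using hw
      have h1 := norm_le_pi_norm (Function.update ω i w - ω) 0
      have h2 := norm_update_sub ω i w
      have h3 : latticePoint (Function.update ω i w) ![1, 0] =
          ω 0 + (Function.update ω i w - ω) 0 := by simp [latticePoint]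
      rw [h3]
      exact (norm_add_le _ _).trans (by linarith)

/-! ### The modified elliptic functions as series of simple fractions -/

lemma logDeriv_mul_cexp {f e : ℂ → ℂ} {e' w : ℂ} (hf : f w ≠ 0) (hd : DifferentiableAt ℂ f w)
    (he : HasDerivAt e e' w) :
    logDeriv (fun v => f v * Complex.exp (e v)) w = logDeriv f w + e' := by
  rw [logDeriv_mul (g := fun v => Complex.exp (e v)) w hf (Complex.exp_ne_zero _) hd
    he.cexp.differentiableAt, logDeriv_apply (fun v => Complex.exp (e v)), he.cexp.deriv,
    mul_div_cancel_left₀ _ (Complex.exp_ne_zero _)]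

lemma ne_latticePoint {ω : Fin 2 → ℂ} {u : ℂ} (hu : u ∉ puncturedLattice ω)
    (a : {a : Fin 2 → ℤ // a ≠ 0}) : u ≠ latticePoint ω a :=
  fun h => hu ⟨a, a.2, h⟩

lemma sigmaDivId_eq_tprod (ω : Fin 2 → ℂ) (u : ℂ) :
    sigmaDivId ω u =
      ∏' a : {a : Fin 2 → ℤ // a ≠ 0}, elementaryFactor (u / latticePoint ω a) := by
  refine tprod_congr fun a => ?_
  rw [elementaryFactor, div_pow, div_div, mul_comm (latticePoint ω _ ^ 2)]

lemma summable_zeta_coeff {ω : Fin 2 → ℂ} (hω : ω ∈ periodRegion) :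
    Summable fun a : {a : Fin 2 → ℤ // a ≠ 0} =>
      ‖1 / latticePoint ω a ^ 2‖ / ‖latticePoint ω a‖ := by
  refine (summable_inv_norm_latticePoint_pow hω (k := 3) le_rfl).congr fun a => ?_
  rw [norm_div, norm_one, norm_pow, div_div, ← pow_succ, one_div]

lemma summable_period_coeff {ω : Fin 2 → ℂ} (hω : ω ∈ periodRegion) (i : Fin 2) :
    Summable fun a : {a : Fin 2 → ℤ // a ≠ 0} =>
      ‖(a.1 i : ℂ) / latticePoint ω a ^ 3‖ / ‖latticePoint ω a‖ := by
  obtain ⟨c, hc, hb⟩ := exists_mul_norm_le_norm_latticePoint hω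
  refine Summable.of_nonneg_of_le (fun _ => by positivity) (fun a => ?_)
    ((summable_inv_norm_pow (k := 3) le_rfl).mul_left (c ^ 4)⁻¹)
  have h1 := one_le_norm_of_ne_zero a.2
  have h2 : ‖(a.1 i : ℂ)‖ ≤ ‖a.1‖ := by
    simpa [Complex.norm_intCast, Int.norm_eq_abs] using norm_le_pi_norm a.1 i
  rw [norm_div, norm_pow, div_div, ← pow_succ, div_eq_mul_inv]
  calc ‖(a.1 i : ℂ)‖ * (‖latticePoint ω a‖ ^ 4)⁻¹
      ≤ ‖a.1‖ * ((c ^ 4)⁻¹ * (‖a.1‖ ^ 4)⁻¹) := by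
        gcongr
        exact inv_norm_latticePoint_pow_le hc hb a.2 4
    _ = (c ^ 4)⁻¹ * (‖a.1‖ ^ 3)⁻¹ := by field_simp

/-- `ζ̃(u) = u² ∑ 1 / (λ² (u - λ)) - G₂ u`. -/
lemma zetaTilde_eq {ω : Fin 2 → ℂ} (hω : ω ∈ periodRegion) {u : ℂ}
    (hu : u ∉ puncturedLattice ω) :
    zetaTilde ω u = u ^ 2 * (∑' a : {a : Fin 2 → ℤ // a ≠ 0},
      (1 / latticePoint ω a ^ 2) / (u - latticePoint ω a)) - eisensteinG2 ω * u := by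
  obtain ⟨c, hc, hb⟩ := exists_mul_norm_le_norm_latticePoint hω
  have hne (a : {a : Fin 2 → ℤ // a ≠ 0}) : latticePoint ω a ≠ 0 :=
    latticePoint_ne_zero hc hb a.2
  have hterm (a : {a : Fin 2 → ℤ // a ≠ 0}) :
      deriv (fun v : ℂ => v / latticePoint ω a) u * (u / latticePoint ω a) ^ 2 /
        (1 - u / latticePoint ω a) =
      -u ^ 2 * ((1 / latticePoint ω a ^ 2) / (u - latticePoint ω a)) := by
    have h1 := hne a
    have h2 : latticePoint ω a - u ≠ 0 := sub_ne_zero.2 (ne_latticePoint hu a).symm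
    have h3 : u - latticePoint ω a = -(latticePoint ω a - u) := by ring
    have hd : deriv (fun v : ℂ => v / latticePoint ω a) u = 1 / latticePoint ω a := by
      simp
    rw [hd, one_sub_div h1, h3]
    field_simp
  obtain ⟨hdiff, hne0, hlog⟩ := logDeriv_tprod_elementaryFactor (U := ball 0 (‖u‖ + 1)) isOpen_ball
    (x := fun (a : {a : Fin 2 → ℤ // a ≠ 0}) v => v / latticePoint ω a)
    ((summable_inv_norm_latticePoint_pow hω (k := 3) le_rfl).mul_left ((‖u‖ + 1) ^ 3))
    (fun a => by fun_prop) (fun a v hv => by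
      have hv' : ‖v‖ ≤ ‖u‖ + 1 := by simpa using (mem_ball.1 hv).le
      rw [norm_div, div_pow, div_eq_mul_inv]
      gcongr) (w := u) (by simp)
    (fun a h => ne_latticePoint hu a ((div_eq_one_iff_eq (hne a)).1 h))
    (by
      simp only [hterm]
      exact (summable_simpleFractions (finite_norm_latticePoint_le hω)
        (summable_zeta_coeff hω) u).mul_left _)
  simp only [← sigmaDivId_eq_tprod, hterm, tsum_mul_left] at hdiff hne0 hlog
  have hexp : HasDerivAt (fun v : ℂ => -(1 / 2) * eisensteinG2 ω * v ^ 2)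
      (-eisensteinG2 ω * u) u := by
    convert! ((hasDerivAt_id u).pow 2).const_mul (-(1 / 2) * eisensteinG2 ω) using 1
    simp
    ring
  rw [zetaTilde]
  change logDeriv (fun v => sigmaDivId ω v * Complex.exp (-(1 / 2) * eisensteinG2 ω * v ^ 2)) u = _
  rw [logDeriv_mul_cexp (f := fun v => sigmaDivId ω v) hne0 hdiff hexp, hlog]
  ring

/-- The logarithmic derivative of `expH` with respect to a period. -/
lemma partialω_expH_div {ω : Fin 2 → ℂ} (hω : ω ∈ periodRegion) (i : Fin 2) {u : ℂ}
    (hu : u ∉ puncturedLattice ω) :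
    partialω i (fun ω' => expH ω' u) ω / expH ω u =
      -u ^ 3 * (∑' a : {a : Fin 2 → ℤ // a ≠ 0},
        ((a.1 i : ℂ) / latticePoint ω a ^ 3) / (u - latticePoint ω a)) -
      1 / 2 * partialω i eisensteinG2 ω * u ^ 2 := by
  obtain ⟨c, hc, ε, hε, h⟩ := exists_uniform_mul_norm_le hω
  have hU (w : ℂ) (hw : w ∈ ball (ω i) ε) (a : Fin 2 → ℤ) :
      c * ‖a‖ ≤ ‖latticePoint (Function.update ω i w) a‖ :=
    (h _ ((norm_update_sub ω i w).trans_lt (by simpa [dist_eq_norm] using hw))).2 a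
  have hb : ∀ a : Fin 2 → ℤ, c * ‖a‖ ≤ ‖latticePoint ω a‖ := by
    simpa using hU (ω i) (mem_ball_self hε)
  have hne (a : {a : Fin 2 → ℤ // a ≠ 0}) : latticePoint ω a ≠ 0 :=
    latticePoint_ne_zero hc hb a.2
  have hterm (a : {a : Fin 2 → ℤ // a ≠ 0}) :
      deriv (fun w : ℂ => u / latticePoint (Function.update ω i w) a) (ω i) *
        (u / latticePoint (Function.update ω i (ω i)) a) ^ 2 /
        (1 - u / latticePoint (Function.update ω i (ω i)) a) =
      u ^ 3 * (((a.1 i : ℂ) / latticePoint ω a ^ 3) / (u - latticePoint ω a)) := by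
    have h1 := hne a
    have h2 : latticePoint ω a - u ≠ 0 := sub_ne_zero.2 (ne_latticePoint hu a).symm
    have h3 : u - latticePoint ω a = -(latticePoint ω a - u) := by ring
    have hl : HasDerivAt (fun w => latticePoint (Function.update ω i w) a) (a.1 i : ℂ) (ω i) := by
      simp only [latticePoint_update]
      simpa using (((hasDerivAt_id (ω i)).sub_const (ω i)).const_mul (a.1 i : ℂ)).const_add
        (latticePoint ω a)
    have hd := ((hasDerivAt_const (ω i) u).fun_div hl (by simpa using h1)).deriv
    rw [hd, Function.update_eq_self, one_sub_div h1, h3]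
    field_simp
    ring
  obtain ⟨hdiff, hne0, hlog⟩ := logDeriv_tprod_elementaryFactor (U := ball (ω i) ε) isOpen_ball
    (x := fun (a : {a : Fin 2 → ℤ // a ≠ 0}) w => u / latticePoint (Function.update ω i w) a)
    ((summable_inv_norm_pow (k := 3) le_rfl).mul_left (‖u‖ ^ 3 * (c ^ 3)⁻¹))
    (fun a w hw => ((differentiableAt_const _).fun_div (differentiable_latticePoint_update ω i a w)
      (latticePoint_ne_zero hc (hU w hw) a.2)).differentiableWithinAt) (fun a w hw => by
      rw [norm_div, div_pow, div_eq_mul_inv, mul_assoc]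
      gcongr
      exact inv_norm_latticePoint_pow_le hc (hU w hw) a.2 3) (w := ω i) (mem_ball_self hε)
    (fun a h => ne_latticePoint hu a
      ((div_eq_one_iff_eq (hne a)).1 (by simpa using h)))
    (by
      simp only [hterm]
      exact (summable_simpleFractions (finite_norm_latticePoint_le hω)
        (summable_period_coeff hω i) u).mul_left _)
  simp only [← sigmaDivId_eq_tprod, hterm, tsum_mul_left] at hdiff hne0 hlog
  have hG := (differentiableAt_eisensteinG2_update hω i).hasDerivAt
  have hexp := ((hG.const_mul (-(1 / 2))).mul_const (u ^ 2))
  have hquot : partialω i (fun ω' => expH ω' u) ω / expH ω u =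
      logDeriv (fun w => expH (Function.update ω i w) u) (ω i) := by
    rw [logDeriv_apply, Function.update_eq_self, partialω]
  rw [hquot]
  change logDeriv (fun w => sigmaDivId (Function.update ω i w) u *
    Complex.exp (-(1 / 2) * eisensteinG2 (Function.update ω i w) * u ^ 2)) (ω i) = _
  rw [logDeriv_mul_cexp (f := fun w => sigmaDivId (Function.update ω i w) u) hne0 hdiff hexp,
    hlog, partialω]
  ring

/-! ### Sums over dilations of a meromorphic function -/

section Dilations

variable {c : ℂ → ℂ} {N : ℕ} {P : Set ℂ} {res : ℂ → ℂ}

/-- For large `m` the point `η / m` lies in a fixed disc about 0 where `c` is analytic and bounded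
by `‖c 0‖ + 1`. The weight is then at most `1 / m²`, as `N ≥ 1`. -/
lemma exists_dilation_bound (hc : AnalyticAt ℂ c 0) (hN : 1 ≤ N) (R : ℝ) :
    ∃ C, ∃ M : ℕ, 1 ≤ M ∧ ∀ m, M ≤ m → ∀ η : ℂ, ‖η‖ ≤ R →
      AnalyticAt ℂ (fun η => 1 / (m : ℂ) ^ (N + 1) * c (η / m)) η ∧
      ‖1 / (m : ℂ) ^ (N + 1) * c (η / m)‖ ≤ C * (1 / (m : ℝ) ^ 2) := by
  have hbd : ∀ᶠ u in 𝓝 (0 : ℂ), ‖c u‖ < ‖c 0‖ + 1 :=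
    hc.continuousAt.norm.eventually (gt_mem_nhds (by linarith))
  obtain ⟨r, hr, hball⟩ := Metric.eventually_nhds_iff.1 (hc.eventually_analyticAt.and hbd)
  obtain ⟨M, hM⟩ := exists_nat_gt (|R| / r)
  refine ⟨‖c 0‖ + 1, M + 1, by omega, fun m hm η hη => ?_⟩
  have hm1 : (1 : ℝ) ≤ m := by exact_mod_cast (by omega : 1 ≤ m)
  have hmM : (M : ℝ) ≤ m := by exact_mod_cast (by omega : M ≤ m)
  have hlt : ‖η / m‖ < r := by
    rw [norm_div, Complex.norm_natCast, div_lt_iff₀ (by linarith)]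
    rw [div_lt_iff₀ hr] at hM
    nlinarith [le_abs_self R]
  obtain ⟨h1, h2⟩ := hball (y := η / m) (by simpa using hlt)
  constructor
  · refine analyticAt_const.mul ?_
    exact AnalyticAt.fun_comp (f := fun η : ℂ => η / m) h1 (analyticAt_id.div_const)
  · rw [norm_mul, mul_comm]
    refine mul_le_mul h2.le ?_ (norm_nonneg _) (by positivity)
    rw [norm_div, norm_one, norm_pow, Complex.norm_natCast]
    exact one_div_le_one_div_of_le (by positivity) (pow_le_pow_right₀ hm1 (by omega))

lemma summable_one_div_add_sq (k : ℕ) : Summable fun m : ℕ => 1 / ((m + k : ℕ) : ℝ) ^ 2 :=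
  (summable_nat_add_iff k).2 (Real.summable_one_div_nat_pow.2 one_lt_two)

lemma summable_dilations (hc : AnalyticAt ℂ c 0) (hN : 1 ≤ N) (η : ℂ) :
    Summable fun m : ℕ => 1 / ((m + 1 : ℕ) : ℂ) ^ (N + 1) * c (η / (m + 1 : ℕ)) := by
  obtain ⟨C, M, -, h⟩ := exists_dilation_bound hc hN ‖η‖
  refine (summable_nat_add_iff M).1 (Summable.of_norm_bounded
    ((summable_one_div_add_sq (M + 1)).mul_left C) fun m => ?_)
  exact (h (m + (M + 1)) (by omega) η le_rfl).2

/-- Near each point, the sum over dilations is a finite partial sum plus an analytic function. -/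
lemma exists_dilations_eq_sum_add (hc : AnalyticAt ℂ c 0) (hN : 1 ≤ N) (z : ℂ) :
    ∃ M : ℕ, 1 ≤ M ∧ ∃ g : ℂ → ℂ, AnalyticAt ℂ g z ∧
      ∀ η, ∑' m : ℕ, 1 / ((m + 1 : ℕ) : ℂ) ^ (N + 1) * c (η / (m + 1 : ℕ)) =
        ∑ m ∈ Finset.range M, 1 / ((m + 1 : ℕ) : ℂ) ^ (N + 1) * c (η / (m + 1 : ℕ)) + g η := by
  obtain ⟨C, M, hM, h⟩ := exists_dilation_bound hc hN (‖z‖ + 1)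
  refine ⟨M, hM, fun η => ∑' m : ℕ, 1 / ((m + M + 1 : ℕ) : ℂ) ^ (N + 1) *
    c (η / (m + M + 1 : ℕ)), ?_, fun η => ?_⟩
  · have hd := Complex.differentiableOn_tsum_of_summable_norm (U := ball 0 (‖z‖ + 1))
      (F := fun (m : ℕ) η => 1 / ((m + M + 1 : ℕ) : ℂ) ^ (N + 1) * c (η / (m + M + 1 : ℕ)))
      ((summable_one_div_add_sq (M + 1)).mul_left C)
      (fun m η hη => (h (m + M + 1) (by omega) η
        (by simpa using (mem_ball.1 hη).le)).1.differentiableAt.differentiableWithinAt)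
      isOpen_ball
      (fun m η hη => (h (m + M + 1) (by omega) η (by simpa using (mem_ball.1 hη).le)).2)
    exact hd.analyticAt (isOpen_ball.mem_nhds (by simp))
  · exact ((summable_dilations hc hN η).sum_add_tsum_nat_add M).symm

lemma meromorphicAt_of_eq_div {z : ℂ} {p f : ℂ → ℂ} (hp : AnalyticAt ℂ p z)
    (h : ∀ᶠ u in 𝓝[≠] z, f u = p u / (u - z) ^ N) : MeromorphicAt f z := by
  have h1 : MeromorphicAt (fun u => p u / (u - z) ^ N) z :=
    hp.meromorphicAt.fun_div (by fun_prop)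
  exact h1.congr (h.mono fun u hu => hu.symm)

lemma tendsto_div_nhdsNE (z : ℂ) {m : ℂ} (hm : m ≠ 0) :
    Tendsto (fun η : ℂ => η / m) (𝓝[≠] z) (𝓝[≠] (z / m)) := by
  refine tendsto_nhdsWithin_iff.2 ⟨?_, ?_⟩
  · exact (continuous_id.div_const m).continuousAt.tendsto.mono_left nhdsWithin_le_nhds
  · filter_upwards [self_mem_nhdsWithin] with η hη h
    exact hη (by simpa [div_left_inj' hm] using h)

open Classical in
/-- The polar part at `z` of a dilation of `c`. -/
lemma exists_polar_part_dilation (hA : ∀ z ∉ P, AnalyticAt ℂ c z)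
    (hP : ∀ z ∈ P, ∃ p, AnalyticAt ℂ p z ∧ p z = res z ∧
      ∀ᶠ u in 𝓝[≠] z, c u = p u / (u - z) ^ N) (hN : 1 ≤ N)
    (hsc : ∀ z : ℂ, ∀ m : ℕ, m ≠ 0 → z / m ∈ P → z ∈ P ∧ res (z / m) = res z / m)
    (z : ℂ) {m : ℕ} (hm : m ≠ 0) :
    ∃ p, AnalyticAt ℂ p z ∧ p z = (if z / m ∈ P then res z / (m : ℂ) ^ 2 else 0) ∧
      ∀ᶠ η in 𝓝[≠] z, 1 / (m : ℂ) ^ (N + 1) * c (η / m) = p η / (η - z) ^ N := by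
  have hm0 : (m : ℂ) ≠ 0 := by exact_mod_cast hm
  have hdiv : AnalyticAt ℂ (fun η : ℂ => η / m) z := analyticAt_id.div_const
  by_cases hz : z / m ∈ P
  -- Rescaling `(η/m - z/m)^N` yields `m^N` against the weight `m^(N+1)`, leaving `1/m`; homogeneity
  -- of `res` supplies the second `1/m`.
  · obtain ⟨p, hp, hpz, hev⟩ := hP _ hz
    refine ⟨fun η => p (η / m) / m, ?_, ?_, ?_⟩
    · exact (AnalyticAt.fun_comp (f := fun η : ℂ => η / m) hp hdiv).div_const
    · simp only [if_pos hz, hpz, (hsc z m hm hz).2]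
      field_simp
    · filter_upwards [(tendsto_div_nhdsNE z hm0).eventually hev, self_mem_nhdsWithin] with η h hη
      have : η - z ≠ 0 := sub_ne_zero.2 hη
      rw [h, ← sub_div, div_pow]
      field_simp
      ring
  · refine ⟨fun η => 1 / (m : ℂ) ^ (N + 1) * c (η / m) * (η - z) ^ N, ?_, ?_, ?_⟩
    · exact (analyticAt_const.mul
        (AnalyticAt.fun_comp (f := fun η : ℂ => η / m) (hA _ hz) hdiv)).mul (by fun_prop)
    · simp [hz, show N ≠ 0 by omega]
    · filter_upwards [self_mem_nhdsWithin] with η hη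
      have : η - z ≠ 0 := sub_ne_zero.2 hη
      field_simp

/-- Poles of the sum over dilations. -/
lemma meromorphicWithPoles_dilations (hA : ∀ z ∉ P, AnalyticAt ℂ c z)
    (hP : ∀ z ∈ P, ∃ p, AnalyticAt ℂ p z ∧ p z = res z ∧
      ∀ᶠ u in 𝓝[≠] z, c u = p u / (u - z) ^ N) (hN : 1 ≤ N)
    (hres : ∀ z ∈ P, res z ≠ 0) (h0 : (0 : ℂ) ∉ P)
    (hsc : ∀ z : ℂ, ∀ m : ℕ, m ≠ 0 → z / m ∈ P → z ∈ P ∧ res (z / m) = res z / m) :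
    MeromorphicWithPoles
      (fun η => ∑' m : ℕ, 1 / ((m + 1 : ℕ) : ℂ) ^ (N + 1) * c (η / (m + 1 : ℕ))) N P := by
  classical
  have hpole : ∀ z ∈ P, ∃ p, AnalyticAt ℂ p z ∧ p z ≠ 0 ∧ ∀ᶠ η in 𝓝[≠] z,
      ∑' m : ℕ, 1 / ((m + 1 : ℕ) : ℂ) ^ (N + 1) * c (η / (m + 1 : ℕ)) = p η / (η - z) ^ N := by
    intro z hz
    obtain ⟨M, hM, g, hg, heq⟩ := exists_dilations_eq_sum_add (hA 0 h0) hN z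
    choose p hpa hpz hpe using fun m : ℕ =>
      exists_polar_part_dilation hA hP hN hsc z (Nat.succ_ne_zero m)
    refine ⟨fun η => ∑ m ∈ Finset.range M, p m η + g η * (η - z) ^ N, ?_, ?_, ?_⟩
    · exact (Finset.analyticAt_fun_sum _ fun m _ => hpa m).add (hg.mul (by fun_prop))
    -- The total leading coefficient is `res z * s`. All terms of `s` are nonnegative and the
    -- undilated one is 1 because `z ∈ P`, so nothing cancels.
    · let s : ℝ := ∑ m ∈ Finset.range M,
        if z / (m.succ : ℕ) ∈ P then 1 / ((m.succ : ℕ) : ℝ) ^ 2 else 0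
      have hs : 0 < s := by
        refine Finset.sum_pos' (fun m _ => by split_ifs <;> positivity)
          ⟨0, Finset.mem_range.2 hM, ?_⟩
        simp [hz]
      have : ∑ m ∈ Finset.range M, p m z = res z * (s : ℂ) := by
        simp only [s, Complex.ofReal_sum, Finset.mul_sum, hpz]
        refine Finset.sum_congr rfl fun m _ => ?_
        split_ifs
        · push_cast; ring
        · simp
      simp only [this, sub_self, zero_pow (show N ≠ 0 by omega), mul_zero, add_zero]
      exact mul_ne_zero (hres z hz) (by exact_mod_cast hs.ne')
    · filter_upwards [(Filter.eventually_all_finset (Finset.range M)).2 fun m _ => hpe m,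
        self_mem_nhdsWithin] with η h hη
      have hne : η - z ≠ 0 := sub_ne_zero.2 hη
      rw [heq, Finset.sum_congr rfl h, ← Finset.sum_div, add_div,
        mul_div_cancel_right₀ _ (pow_ne_zero _ hne)]
  have hana : ∀ z ∉ P, AnalyticAt ℂ
      (fun η => ∑' m : ℕ, 1 / ((m + 1 : ℕ) : ℂ) ^ (N + 1) * c (η / (m + 1 : ℕ))) z := by
    intro z hz
    obtain ⟨M, hM, g, hg, heq⟩ := exists_dilations_eq_sum_add (hA 0 h0) hN z
    simp only [heq]
    refine AnalyticAt.add (Finset.analyticAt_fun_sum _ fun m _ => ?_) hg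
    refine analyticAt_const.mul (AnalyticAt.fun_comp (f := fun η : ℂ => η / (m + 1 : ℕ)) (hA _ ?_)
      analyticAt_id.div_const)
    exact fun h => hz (hsc z (m + 1) (Nat.succ_ne_zero m) h).1
  have hmer : ∀ z ∈ P, MeromorphicAt
      (fun η => ∑' m : ℕ, 1 / ((m + 1 : ℕ) : ℂ) ^ (N + 1) * c (η / (m + 1 : ℕ))) z := by
    intro z hz
    obtain ⟨p, hp, -, he⟩ := hpole z hz
    exact meromorphicAt_of_eq_div hp he
  refine ⟨fun z => ?_, fun z hz => ?_, hana⟩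
  · by_cases hz : z ∈ P
    · exact hmer z hz
    · exact (hana z hz).meromorphicAt
  · obtain ⟨p, hp, hpz, he⟩ := hpole z hz
    refine (meromorphicOrderAt_eq_int_iff (hmer z hz)).2 ⟨p, hp, hpz, he.mono fun η h => ?_⟩
    rw [h, zpow_neg, zpow_natCast, smul_eq_mul, div_eq_mul_inv, mul_comm]

lemma convergesOnCompacts_dilations (hA : ∀ z ∉ P, AnalyticAt ℂ c z)
    (hP : ∀ z ∈ P, ∃ p, AnalyticAt ℂ p z ∧ p z = res z ∧
      ∀ᶠ u in 𝓝[≠] z, c u = p u / (u - z) ^ N) (hN : 1 ≤ N) (h0 : (0 : ℂ) ∉ P) :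
    ConvergesOnCompacts (fun m η => 1 / (m : ℂ) ^ (N + 1) * c (η / m)) := by
  refine ⟨fun m hm z => ?_, fun K hK => ?_⟩
  · have hc : MeromorphicAt c (z / m) := by
      by_cases hz : z / m ∈ P
      · obtain ⟨p, hp, -, he⟩ := hP _ hz
        exact meromorphicAt_of_eq_div hp he
      · exact (hA _ hz).meromorphicAt
    have hdiv : AnalyticAt ℂ (fun η : ℂ => η / m) z := analyticAt_id.div_const
    exact (MeromorphicAt.const _ z).fun_mul
      (MeromorphicAt.comp_analyticAt (f := c) (g := fun η : ℂ => η / m) hc hdiv)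
  · obtain ⟨R, hR⟩ := hK.isBounded.exists_norm_le
    obtain ⟨C, M, hM, h⟩ := exists_dilation_bound (hA 0 h0) hN R
    refine ⟨M, hM, fun m hm z hz => (h m hm z (hR z hz)).1, ?_, ?_⟩
    · refine (HasSumUniformlyOn.of_norm_le_summable ((summable_one_div_add_sq M).mul_left C)
        fun m η hη => ?_).summableUniformlyOn
      rw [norm_norm]
      exact (h (m + M) (by omega) η (hR η hη)).2
    · exact (HasSumUniformlyOn.of_norm_le_summable ((summable_one_div_add_sq M).mul_left C)
        fun m η hη => (h (m + M) (by omega) η (hR η hη)).2).summableUniformlyOn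

/-- The Taylor expansion of the sum over dilations. -/
lemma hasSum_taylor_dilations {γ : ℕ → ℂ} {r : ℝ}
    (hγ : ∀ u : ℂ, ‖u‖ < r → HasSum (fun n => γ n * u ^ n) (c u)) (hN : 1 ≤ N) {η : ℂ}
    (hη : ‖η‖ < r) :
    HasSum (fun n => γ n * (∑' m : ℕ, 1 / ((m + 1 : ℕ) : ℂ) ^ (n + N + 1)) * η ^ n)
      (∑' m : ℕ, 1 / ((m + 1 : ℕ) : ℂ) ^ (N + 1) * c (η / (m + 1 : ℕ))) := by
  have hone (m : ℕ) : (1 : ℝ) ≤ ((m + 1 : ℕ) : ℝ) := by exact_mod_cast Nat.succ_pos m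
  have hle (m k : ℕ) : ‖1 / ((m + 1 : ℕ) : ℂ) ^ k‖ = 1 / ((m + 1 : ℕ) : ℝ) ^ k := by
    rw [norm_div, norm_one, norm_pow, Complex.norm_natCast]
  -- Summing over the dilation index first gives the zeta value. Since `(m+1)^(-(n+N+1)) ≤
  -- (m+1)^(-2)`, the double series is dominated by a product of two convergent ones.
  let F : ℕ × ℕ → ℂ := fun p => γ p.2 * (1 / ((p.1 + 1 : ℕ) : ℂ) ^ (p.2 + N + 1)) * η ^ p.2
  have hF : Summable F := by
    refine Summable.of_norm_bounded ((summable_one_div_add_sq 1).mul_of_nonneg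
      (hγ η hη).summable.norm (fun _ => by positivity) fun _ => norm_nonneg _) fun p => ?_
    have h1 : ‖F p‖ = 1 / ((p.1 + 1 : ℕ) : ℝ) ^ (p.2 + N + 1) * ‖γ p.2 * η ^ p.2‖ := by
      simp only [F, norm_mul, hle]; ring
    rw [h1]
    refine mul_le_mul_of_nonneg_right ?_ (norm_nonneg _)
    exact one_div_le_one_div_of_le (by positivity) (pow_le_pow_right₀ (hone _) (by omega))
  refine hasSum_comm_of_summable hF (fun m => ?_) fun n => ?_
  · have hlt : ‖η / ((m + 1 : ℕ) : ℂ)‖ < r := by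
      rw [norm_div, Complex.norm_natCast]
      exact (div_le_self (norm_nonneg _) (hone m)).trans_lt hη
    refine ((hγ _ hlt).mul_left (1 / ((m + 1 : ℕ) : ℂ) ^ (N + 1))).congr_fun fun n => ?_
    have : ((m + 1 : ℕ) : ℂ) ≠ 0 := by exact_mod_cast Nat.succ_ne_zero m
    simp only [F, div_pow, add_assoc, pow_add _ n (N + 1)]
    field_simp
  · simp only [F, tsum_mul_right, tsum_mul_left]

end Dilations

/-! ### Poles of the modified elliptic functions -/

lemma eventually_nhdsNE_notMem_puncturedLattice {ω : Fin 2 → ℂ} (hω : ω ∈ periodRegion) (z : ℂ) :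
    ∀ᶠ u in 𝓝[≠] z, u ∉ puncturedLattice ω := by
  have hfin := ((finite_norm_latticePoint_le hω (‖z‖ + 1)).image
    fun a => latticePoint ω a.1).subset (Set.sdiff_subset (t := {z}))
  have hnorm : ∀ᶠ u in 𝓝 z, ‖u‖ < ‖z‖ + 1 :=
    continuous_norm.continuousAt.eventually (gt_mem_nhds (by linarith))
  filter_upwards [nhdsWithin_le_nhds (hfin.isClosed.isOpen_compl.mem_nhds (by simp)),
    nhdsWithin_le_nhds hnorm, self_mem_nhdsWithin] with u h1 h2 h3 hu
  obtain ⟨a, ha, rfl⟩ := hu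
  exact h1 ⟨⟨⟨a, ha⟩, h2.le, rfl⟩, h3⟩

lemma eventually_nhds_notMem_puncturedLattice {ω : Fin 2 → ℂ} (hω : ω ∈ periodRegion) {z : ℂ}
    (hz : z ∉ puncturedLattice ω) : ∀ᶠ u in 𝓝 z, u ∉ puncturedLattice ω := by
  have h := eventually_nhdsNE_notMem_puncturedLattice hω z
  rw [eventually_nhdsWithin_iff] at h
  filter_upwards [h] with u hu
  by_cases huz : u = z
  · rwa [huz]
  · exact hu huz

lemma latticePoint_subtype_injective {ω : Fin 2 → ℂ} (hω : ω ∈ periodRegion) :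
    Function.Injective fun a : {a : Fin 2 → ℤ // a ≠ 0} => latticePoint ω a :=
  (latticePoint_injective hω).comp Subtype.val_injective

lemma zero_notMem_puncturedLattice {ω : Fin 2 → ℂ} (hω : ω ∈ periodRegion) :
    (0 : ℂ) ∉ puncturedLattice ω := by
  rintro ⟨a, ha, h⟩
  obtain ⟨c, hc, hb⟩ := exists_mul_norm_le_norm_latticePoint hω
  exact latticePoint_ne_zero hc hb ha h.symm

lemma zetaTilde_eventuallyEq {ω : Fin 2 → ℂ} (hω : ω ∈ periodRegion) {z : ℂ}
    (hz : z ∉ puncturedLattice ω) :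
    zetaTilde ω =ᶠ[𝓝 z] fun u => u ^ 2 * (∑' a : {a : Fin 2 → ℤ // a ≠ 0},
      (1 / latticePoint ω a ^ 2) / (u - latticePoint ω a)) - eisensteinG2 ω * u := by
  filter_upwards [eventually_nhds_notMem_puncturedLattice hω hz] with u hu
  exact zetaTilde_eq hω hu

lemma analyticAt_zetaTilde {ω : Fin 2 → ℂ} (hω : ω ∈ periodRegion) {z : ℂ}
    (hz : z ∉ puncturedLattice ω) : AnalyticAt ℂ (zetaTilde ω) z := by
  have h := analyticAt_simpleFractions (finite_norm_latticePoint_le hω) (summable_zeta_coeff hω)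
    (z := z) fun a ha => absurd ha.symm (ne_latticePoint hz a)
  refine AnalyticAt.congr ?_ (zetaTilde_eventuallyEq hω hz).symm
  exact ((analyticAt_id.pow 2).mul h).sub (by fun_prop)

lemma analyticAt_curlyF {ω : Fin 2 → ℂ} (hω : ω ∈ periodRegion) {z : ℂ}
    (hz : z ∉ puncturedLattice ω) : AnalyticAt ℂ (curlyF ω) z := by
  have h := analyticAt_zetaTilde hω hz
  exact (analyticAt_const.mul h).sub (analyticAt_id.mul h.deriv.neg)

/-- Near a nonzero lattice point, `ζ̃` is the sum of a simple fraction and an analytic function. -/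
lemma exists_polar_part_zetaTilde {ω : Fin 2 → ℂ} (hω : ω ∈ periodRegion) {z : ℂ}
    (hz : z ∈ puncturedLattice ω) :
    ∃ g : ℂ → ℂ, AnalyticAt ℂ g z ∧ ∀ᶠ u in 𝓝[≠] z, zetaTilde ω u = 1 / (u - z) + g u := by
  have hz0 : z ≠ 0 := fun h => zero_notMem_puncturedLattice hω (h ▸ hz)
  obtain ⟨a, ha, rfl⟩ := hz
  obtain ⟨g, hg, hS⟩ := exists_analyticAt_simpleFractions (latticePoint_subtype_injective hω)
    (finite_norm_latticePoint_le hω) (summable_zeta_coeff hω) ⟨a, ha⟩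
  set z := latticePoint ω a
  -- From `u² = z² + (u - z)(u + z)`, the singular term `u² / (z² (u - z))` equals `1 / (u - z) + (u
  -- + z) / z²`.
  refine ⟨fun u => (u + z) / z ^ 2 + u ^ 2 * g u - eisensteinG2 ω * u, ?_, ?_⟩
  · have : AnalyticAt ℂ g z := hg
    fun_prop
  · filter_upwards [eventually_nhdsNE_notMem_puncturedLattice hω z, self_mem_nhdsWithin]
      with u hu hne
    have : u - z ≠ 0 := sub_ne_zero.2 hne
    rw [zetaTilde_eq hω hu, hS u]
    change u ^ 2 * (1 / z ^ 2 / (u - z) + g u) - _ = _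
    field_simp
    ring

/-- As `𝒻 = 2 ζ̃ + u ζ̃'`, the double pole comes from differentiating `1 / (u - z)`, and the factor
`u` gives the leading coefficient `-z`. -/
lemma exists_polar_part_curlyF {ω : Fin 2 → ℂ} (hω : ω ∈ periodRegion) {z : ℂ}
    (hz : z ∈ puncturedLattice ω) :
    ∃ p : ℂ → ℂ, AnalyticAt ℂ p z ∧ p z = -z ∧
      ∀ᶠ u in 𝓝[≠] z, curlyF ω u = p u / (u - z) ^ 2 := by
  obtain ⟨g, hg, he⟩ := exists_polar_part_zetaTilde hω hz
  refine ⟨fun u => 2 * (u - z) - u + (u - z) ^ 2 * (2 * g u + u * deriv g u), ?_, by simp, ?_⟩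
  · have := hg.deriv
    fun_prop
  · have he' : zetaTilde ω =ᶠ[𝓝[≠] z] fun u => 1 / (u - z) + g u := he
    filter_upwards [he, he'.nhdsNE_deriv, self_mem_nhdsWithin,
      nhdsWithin_le_nhds hg.eventually_analyticAt] with u h1 h2 hne hgu
    have hu : u - z ≠ 0 := sub_ne_zero.2 hne
    have hd : HasDerivAt (fun u => 1 / (u - z) + g u) (-1 / (u - z) ^ 2 + deriv g u) u := by
      have h3 : HasDerivAt (fun u => u - z) 1 u := (hasDerivAt_id u).sub_const z
      have h4 := ((hasDerivAt_const u (1 : ℂ)).fun_div h3 hu).fun_add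
        hgu.differentiableAt.hasDerivAt
      simpa using h4
    rw [curlyF, wpTilde, h1, h2, hd.deriv]
    field_simp
    ring

/-- The series of simple fractions that represents `𝓀ᵢ`. -/
noncomputable def periodFractions (i : Fin 2) (ω : Fin 2 → ℂ) (u : ℂ) : ℂ :=
  -u ^ 3 * (∑' a : {a : Fin 2 → ℤ // a ≠ 0},
    ((a.1 i : ℂ) / latticePoint ω a ^ 3) / (u - latticePoint ω a)) -
  1 / 2 * partialω i eisensteinG2 ω * u ^ 2

/-- At a lattice point with `aᵢ = 0` the numerator of the only possibly singular fraction vanishes.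
-/
lemma analyticAt_periodFractions {ω : Fin 2 → ℂ} (hω : ω ∈ periodRegion) (i : Fin 2) {z : ℂ}
    (hz : z ∉ latticePart ω i) : AnalyticAt ℂ (periodFractions i ω) z := by
  have h := analyticAt_simpleFractions (finite_norm_latticePoint_le hω)
    (summable_period_coeff hω i) (z := z) fun a ha => by
      have : a.1 i = 0 := by
        by_contra hne
        exact hz ⟨a, hne, ha.symm⟩
      simp [this]
  exact ((analyticAt_id.pow 3).neg.mul h).sub (by fun_prop)

lemma exists_polar_part_periodFractions {ω : Fin 2 → ℂ} (hω : ω ∈ periodRegion) (i : Fin 2)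
    {a : Fin 2 → ℤ} (ha : a ≠ 0) :
    ∃ p : ℂ → ℂ, AnalyticAt ℂ p (latticePoint ω a) ∧ p (latticePoint ω a) = -(a i : ℂ) ∧
      ∀ᶠ u in 𝓝[≠] (latticePoint ω a),
        periodFractions i ω u = p u / (u - latticePoint ω a) ^ 1 := by
  obtain ⟨c, hc, hb⟩ := exists_mul_norm_le_norm_latticePoint hω
  have hz0 := latticePoint_ne_zero hc hb ha
  obtain ⟨g, hg, hS⟩ := exists_analyticAt_simpleFractions (latticePoint_subtype_injective hω)
    (finite_norm_latticePoint_le hω) (summable_period_coeff hω i) ⟨a, ha⟩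
  set z := latticePoint ω a
  refine ⟨fun u => -u ^ 3 * (a i / z ^ 3) + (u - z) * (-u ^ 3 * g u -
    1 / 2 * partialω i eisensteinG2 ω * u ^ 2), ?_, ?_, ?_⟩
  · have : AnalyticAt ℂ g z := hg
    fun_prop
  · field_simp
    ring
  · filter_upwards [self_mem_nhdsWithin] with u hne
    have : u - z ≠ 0 := sub_ne_zero.2 hne
    rw [periodFractions, hS u]
    change -u ^ 3 * (a i / z ^ 3 / (u - z) + g u) - _ = _
    field_simp
    ring

lemma meromorphicAt_periodFractions {ω : Fin 2 → ℂ} (hω : ω ∈ periodRegion) (i : Fin 2) (z : ℂ) :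
    MeromorphicAt (periodFractions i ω) z := by
  by_cases hz : z ∈ latticePart ω i
  · obtain ⟨a, ha, rfl⟩ := hz
    obtain ⟨p, hp, -, he⟩ := exists_polar_part_periodFractions hω i (a := a) fun h => ha (by simp [h])
    exact meromorphicAt_of_eq_div hp he
  · exact (analyticAt_periodFractions hω i hz).meromorphicAt

lemma curlyK_eventuallyEq_nhdsNE {ω : Fin 2 → ℂ} (hω : ω ∈ periodRegion) (i : Fin 2) (z : ℂ) :
    curlyK i ω =ᶠ[𝓝[≠] z] periodFractions i ω := by
  have h (z : ℂ) : (fun u => partialω i (fun ω' => expH ω' u) ω / expH ω u) =ᶠ[𝓝[≠] z]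
      periodFractions i ω := by
    filter_upwards [eventually_nhdsNE_notMem_puncturedLattice hω z] with u hu
    exact partialω_expH_div hω i hu
  have hmer : MeromorphicOn (fun u => partialω i (fun ω' => expH ω' u) ω / expH ω u) Set.univ :=
    fun z _ => (meromorphicAt_periodFractions hω i z).congr (h z).symm
  exact (hmer.toMeromorphicNFOn_eq_self_on_nhdsNE (Set.mem_univ z)).trans (h z)

/-- Agreement on a punctured neighbourhood extends to the centre because both functions are in
meromorphic normal form there. -/
lemma curlyK_eventuallyEq {ω : Fin 2 → ℂ} (hω : ω ∈ periodRegion) (i : Fin 2) {z : ℂ}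
    (hz : z ∉ latticePart ω i) : curlyK i ω =ᶠ[𝓝 z] periodFractions i ω :=
  ((meromorphicNFOn_toMeromorphicNFOn _ _
    (Set.mem_univ z)).eventuallyEq_nhdsNE_iff_eventuallyEq_nhds
    (analyticAt_periodFractions hω i hz).meromorphicNFAt).1 (curlyK_eventuallyEq_nhdsNE hω i z)

lemma analyticAt_curlyK {ω : Fin 2 → ℂ} (hω : ω ∈ periodRegion) (i : Fin 2) {z : ℂ}
    (hz : z ∉ latticePart ω i) : AnalyticAt ℂ (curlyK i ω) z :=
  (analyticAt_periodFractions hω i hz).congr (curlyK_eventuallyEq hω i hz).symm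

lemma exists_polar_part_curlyK {ω : Fin 2 → ℂ} (hω : ω ∈ periodRegion) (i : Fin 2)
    {a : Fin 2 → ℤ} (ha : a ≠ 0) :
    ∃ p : ℂ → ℂ, AnalyticAt ℂ p (latticePoint ω a) ∧ p (latticePoint ω a) = -(a i : ℂ) ∧
      ∀ᶠ u in 𝓝[≠] (latticePoint ω a), curlyK i ω u = p u / (u - latticePoint ω a) ^ 1 := by
  obtain ⟨p, hp, hpz, he⟩ := exists_polar_part_periodFractions hω i ha
  refine ⟨p, hp, hpz, ?_⟩
  filter_upwards [he, curlyK_eventuallyEq_nhdsNE hω i _] with u h1 h2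
  rw [h2, h1]

lemma latticePart_subset (ω : Fin 2 → ℂ) (i : Fin 2) : latticePart ω i ⊆ puncturedLattice ω := by
  rintro z ⟨a, ha, rfl⟩
  exact ⟨a, fun h => ha (by simp [h]), rfl⟩

lemma latticePoint_nsmul (ω : Fin 2 → ℂ) (m : ℕ) (a : Fin 2 → ℤ) :
    latticePoint ω (m • a) = m * latticePoint ω a := by
  simp [latticePoint]; ring

/-- The `i`-th coordinate of a lattice point, and zero off the lattice. -/
noncomputable def latticeCoord (ω : Fin 2 → ℂ) (i : Fin 2) (z : ℂ) : ℤ :=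
  Function.extend (latticePoint ω) (fun a => a i) 0 z

lemma latticeCoord_latticePoint {ω : Fin 2 → ℂ} (hω : ω ∈ periodRegion) (i : Fin 2)
    (a : Fin 2 → ℤ) : latticeCoord ω i (latticePoint ω a) = a i :=
  (latticePoint_injective hω).extend_apply _ _ a

/-! ### Taylor expansions of the modified elliptic functions -/

/-- Odd functions on the punctured lattice have sum zero. -/
lemma tsum_eq_zero_of_odd {f : (Fin 2 → ℤ) → ℂ} (hf : ∀ a, f (-a) = -f a) :
    ∑' a : {a : Fin 2 → ℤ // a ≠ 0}, f a = 0 := by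
  let e : {a : Fin 2 → ℤ // a ≠ 0} ≃ {a : Fin 2 → ℤ // a ≠ 0} :=
    (Equiv.neg (Fin 2 → ℤ)).subtypeEquiv fun a => by simp
  have h := e.tsum_eq fun a => f a.1
  have h' (a : {a : Fin 2 → ℤ // a ≠ 0}) : f (e a).1 = -f a.1 := hf a.1
  simp only [h', tsum_neg] at h
  exact self_eq_neg.1 h.symm

lemma latticePoint_neg (ω : Fin 2 → ℂ) (a : Fin 2 → ℤ) :
    latticePoint ω (-a) = -latticePoint ω a := by
  simp [latticePoint]; ring

/-- The Taylor coefficients of `ζ̃`. -/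
noncomputable def zetaCoeff (ω : Fin 2 → ℂ) (n : ℕ) : ℂ :=
  if Odd n then -eisensteinG (n + 1) ω else 0

lemma zetaCoeff_add_two (ω : Fin 2 → ℂ) (n : ℕ) :
    zetaCoeff ω (n + 2) = -∑' a : {a : Fin 2 → ℤ // a ≠ 0},
      (1 / latticePoint ω a ^ 2) / latticePoint ω a ^ (n + 1) := by
  have hterm (a : Fin 2 → ℤ) : (1 / latticePoint ω a ^ 2) / latticePoint ω a ^ (n + 1) =
      1 / latticePoint ω a ^ (n + 3) := by
    rw [div_div, ← pow_add]; congr 2; ring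
  simp only [hterm]
  rcases Nat.even_or_odd n with hn | hn
  · rw [zetaCoeff, if_neg (by rw [Nat.not_odd_iff_even]; exact hn.add even_two)]
    have hodd : Odd (n + 3) := hn.add_odd (by decide)
    rw [tsum_eq_zero_of_odd (f := fun a => 1 / latticePoint ω a ^ (n + 3)), neg_zero]
    intro a
    rw [latticePoint_neg, hodd.neg_pow, div_neg]
  · rw [zetaCoeff, if_pos (hn.add_even even_two), eisensteinG, if_neg (by omega)]

lemma le_norm_latticePoint {ω : Fin 2 → ℂ} {c : ℝ} (hc : 0 < c)
    (hb : ∀ a : Fin 2 → ℤ, c * ‖a‖ ≤ ‖latticePoint ω a‖) {a : Fin 2 → ℤ} (ha : a ≠ 0) :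
    c ≤ ‖latticePoint ω a‖ := by
  nlinarith [hb a, one_le_norm_of_ne_zero ha]

/-- The factor `u²` shifts the Taylor series of the simple fractions by two. The two initial
coefficients are 0 and `-G₂`, the latter from the term `-G₂ u`. -/
lemma exists_hasSum_taylor_zetaTilde {ω : Fin 2 → ℂ} (hω : ω ∈ periodRegion) :
    ∃ r > 0, ∀ u : ℂ, ‖u‖ < r → HasSum (fun n => zetaCoeff ω n * u ^ n) (zetaTilde ω u) := by
  obtain ⟨c, hc, hb⟩ := exists_mul_norm_le_norm_latticePoint hω
  refine ⟨c, hc, fun u hu => ?_⟩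
  have hmem : u ∉ puncturedLattice ω := by
    rintro ⟨a, ha, rfl⟩
    exact absurd (le_norm_latticePoint hc hb ha) (not_le.2 hu)
  have h := (hasSum_taylor_simpleFractions
    (lam := fun a : {a : Fin 2 → ℤ // a ≠ 0} => latticePoint ω a)
    (fun a => le_norm_latticePoint hc hb a.2) (summable_zeta_coeff hω) hu).mul_left (u ^ 2)
  rw [zetaTilde_eq hω hmem]
  have h2 := (hasSum_nat_add_iff (f := fun n => zetaCoeff ω n * u ^ n) 2).1
    (h.congr_fun fun n => by rw [zetaCoeff_add_two]; ring)
  convert! h2 using 1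
  simp [Finset.sum_range_succ, zetaCoeff, eisensteinG]
  ring

/-- The operator `2 + u d/du` multiplies the coefficient of `u ^ n` by `n + 2`. -/
lemma exists_hasSum_taylor_curlyF {ω : Fin 2 → ℂ} (hω : ω ∈ periodRegion) :
    ∃ r > 0, ∀ u : ℂ, ‖u‖ < r →
      HasSum (fun n : ℕ => (n + 2) * zetaCoeff ω n * u ^ n) (curlyF ω u) := by
  obtain ⟨r, hr, h⟩ := exists_hasSum_taylor_zetaTilde hω
  refine ⟨r, hr, fun u hu => ?_⟩
  obtain ⟨ρ, hρ, hρr⟩ := exists_between hu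
  have hρ0 : 0 ≤ ρ := (norm_nonneg u).trans hρ.le
  have hd := Complex.hasSum_deriv_of_summable_norm (U := ball 0 ρ)
    (F := fun n w => zetaCoeff ω n * w ^ n) (u := fun n => ‖zetaCoeff ω n * (ρ : ℂ) ^ n‖)
    (h ρ (by simpa [abs_of_nonneg hρ0] using hρr)).summable.norm (fun n => by fun_prop) isOpen_ball
    (fun n w hw => by
      have hw' : ‖w‖ ≤ ρ := by simpa using (mem_ball.1 hw).le
      simp only [norm_mul, norm_pow, Complex.norm_real, Real.norm_of_nonneg hρ0]
      gcongr) (z := u) (by simpa using hρ)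
  have hev : (fun w => ∑' n, zetaCoeff ω n * w ^ n) =ᶠ[𝓝 u] zetaTilde ω := by
    filter_upwards [isOpen_ball.mem_nhds (show u ∈ ball 0 ρ by simpa using hρ)] with w hw
    exact (h w ((by simpa using hw : ‖w‖ < ρ).trans hρr)).tsum_eq
  rw [hev.deriv_eq] at hd
  have hF : curlyF ω u = 2 * zetaTilde ω u + u * deriv (zetaTilde ω) u := by
    rw [curlyF, wpTilde]; ring
  rw [hF]
  refine (((h u hu).mul_left 2).add (hd.mul_left u)).congr_fun fun n => ?_
  rw [deriv_const_mul_field, deriv_pow_field]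
  rcases n with _ | n
  · simp
  · simp only [Nat.add_sub_cancel]; ring

/-- Termwise differentiation of the Eisenstein series. -/
lemma partialω_eisensteinG {ω : Fin 2 → ℂ} (hω : ω ∈ periodRegion) (i : Fin 2) {n : ℕ}
    (hn : 3 ≤ n) :
    partialω i (eisensteinG n) ω =
      -n * ∑' a : {a : Fin 2 → ℤ // a ≠ 0}, (a.1 i : ℂ) / latticePoint ω a ^ (n + 1) := by
  obtain ⟨c, hc, ε, hε, h⟩ := exists_uniform_mul_norm_le hω
  have hU (w : ℂ) (hw : w ∈ ball (ω i) ε) (a : Fin 2 → ℤ) :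
      c * ‖a‖ ≤ ‖latticePoint (Function.update ω i w) a‖ :=
    (h _ ((norm_update_sub ω i w).trans_lt (by simpa [dist_eq_norm] using hw))).2 a
  have hd := Complex.hasSum_deriv_of_summable_norm (U := ball (ω i) ε)
    (F := fun (a : {a : Fin 2 → ℤ // a ≠ 0}) w => 1 / latticePoint (Function.update ω i w) a ^ n)
    ((summable_inv_norm_pow hn).mul_left (c ^ n)⁻¹)
    (fun a w hw => ((differentiableAt_const _).fun_div
      ((differentiable_latticePoint_update ω i a w).fun_pow n)
      (pow_ne_zero n (latticePoint_ne_zero hc (hU w hw) a.2))).differentiableWithinAt) isOpen_ball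
    (fun a w hw => by
      rw [norm_div, norm_one, norm_pow, one_div]
      exact inv_norm_latticePoint_pow_le hc (hU w hw) a.2 n) (mem_ball_self hε)
  have hfun : (fun w => eisensteinG n (Function.update ω i w)) = fun w =>
      ∑' a : {a : Fin 2 → ℤ // a ≠ 0}, 1 / latticePoint (Function.update ω i w) a ^ n := by
    funext w
    rw [eisensteinG, if_neg (by omega)]
  rw [partialω, hfun, ← hd.tsum_eq, ← tsum_mul_left]
  refine tsum_congr fun a => ?_
  have hne : latticePoint ω a ≠ 0 := by
    simpa using latticePoint_ne_zero hc (hU _ (mem_ball_self hε)) a.2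
  have hl : HasDerivAt (fun w => latticePoint (Function.update ω i w) a) (a.1 i : ℂ) (ω i) := by
    simp only [latticePoint_update]
    simpa using (((hasDerivAt_id (ω i)).sub_const (ω i)).const_mul (a.1 i : ℂ)).const_add
      (latticePoint ω a)
  obtain ⟨k, rfl⟩ : ∃ k, n = k + 1 := ⟨n - 1, by omega⟩
  rw [((hasDerivAt_const (ω i) (1 : ℂ)).fun_div (hl.fun_pow (k + 1))
    (pow_ne_zero _ (by simpa using hne))).deriv, Function.update_eq_self]
  simp only [Nat.add_sub_cancel]
  field_simp
  ring

/-- The Taylor coefficients of `𝓀ᵢ`. -/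
noncomputable def periodCoeff (i : Fin 2) (ω : Fin 2 → ℂ) (n : ℕ) : ℂ :=
  if Even n ∧ 2 ≤ n then -(partialω i (eisensteinG n) ω / n) else 0

lemma periodCoeff_add_three {ω : Fin 2 → ℂ} (hω : ω ∈ periodRegion) (i : Fin 2) (n : ℕ) :
    periodCoeff i ω (n + 3) = ∑' a : {a : Fin 2 → ℤ // a ≠ 0},
      ((a.1 i : ℂ) / latticePoint ω a ^ 3) / latticePoint ω a ^ (n + 1) := by
  have hterm (a : Fin 2 → ℤ) : ((a i : ℂ) / latticePoint ω a ^ 3) / latticePoint ω a ^ (n + 1) =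
      (a i : ℂ) / latticePoint ω a ^ (n + 3 + 1) := by
    rw [div_div, ← pow_add]; congr 2; ring
  simp only [hterm]
  rcases Nat.even_or_odd n with hn | hn
  · have hodd : Odd (n + 3) := hn.add_odd (by decide)
    rw [periodCoeff, if_neg fun h => Nat.not_even_iff_odd.2 hodd h.1]
    rw [tsum_eq_zero_of_odd (f := fun a => (a i : ℂ) / latticePoint ω a ^ (n + 3 + 1))]
    intro a
    rw [latticePoint_neg, hodd.add_one.neg_pow]
    simp [neg_div]
  · have heven : Even (n + 3) := hn.add_odd (by decide)
    rw [periodCoeff, if_pos ⟨heven, by omega⟩, partialω_eisensteinG hω i (by omega)]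
    have : ((n + 3 : ℕ) : ℂ) ≠ 0 := by exact_mod_cast Nat.succ_ne_zero (n + 2)
    field_simp

lemma zero_notMem_latticePart {ω : Fin 2 → ℂ} (hω : ω ∈ periodRegion) (i : Fin 2) :
    (0 : ℂ) ∉ latticePart ω i :=
  fun h => zero_notMem_puncturedLattice hω (latticePart_subset ω i h)

/-- Here the shift is by three, and the only nonzero initial coefficient is that of `u²`, given by
the derivative of `G₂`. -/
lemma exists_hasSum_taylor_curlyK {ω : Fin 2 → ℂ} (hω : ω ∈ periodRegion) (i : Fin 2) :
    ∃ r > 0, ∀ u : ℂ, ‖u‖ < r → HasSum (fun n => periodCoeff i ω n * u ^ n) (curlyK i ω u) := by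
  obtain ⟨c, hc, hb⟩ := exists_mul_norm_le_norm_latticePoint hω
  refine ⟨c, hc, fun u hu => ?_⟩
  have hmem : u ∉ latticePart ω i := by
    intro h
    obtain ⟨a, ha, rfl⟩ := latticePart_subset ω i h
    exact absurd (le_norm_latticePoint hc hb ha) (not_le.2 hu)
  have h := (hasSum_taylor_simpleFractions
    (lam := fun a : {a : Fin 2 → ℤ // a ≠ 0} => latticePoint ω a)
    (fun a => le_norm_latticePoint hc hb a.2) (summable_period_coeff hω i) hu).mul_left (-u ^ 3)
  rw [(curlyK_eventuallyEq hω i hmem).eq_of_nhds, periodFractions]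
  have h2 := (hasSum_nat_add_iff (f := fun n => periodCoeff i ω n * u ^ n) 3).1
    (h.congr_fun fun n => by rw [periodCoeff_add_three hω]; ring)
  have hG : eisensteinG 2 = eisensteinG2 := by
    funext ω; simp [eisensteinG]
  convert! h2 using 1
  simp [Finset.sum_range_succ, periodCoeff, hG]
  ring

/-! ### Comparison with the Borel transforms -/

lemma tsum_one_div_succ_pow {g : ℕ} (hg : g ≠ 0) :
    ∑' m : ℕ, 1 / ((m + 1 : ℕ) : ℂ) ^ (2 * g) =
      -((bernoulli (2 * g) : ℂ) * (2 * Real.pi * Complex.I) ^ (2 * g) /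
        (2 * ((2 * g).factorial : ℂ))) := by
  -- The removed term, of index 0, is zero because `1 / 0 = 0`.
  have h := (hasSum_nat_add_iff' 1).2 (hasSum_zeta_nat hg)
  have h' := Complex.ofRealCLM.hasSum h
  simp only [Complex.ofRealCLM_apply] at h'
  have e : ∀ m : ℕ, ((1 / ((m + 1 : ℕ) : ℝ) ^ (2 * g) : ℝ) : ℂ) =
      1 / ((m + 1 : ℕ) : ℂ) ^ (2 * g) := fun m => by push_cast; rfl
  simp only [e] at h'
  rw [h'.tsum_eq]
  obtain ⟨k, rfl⟩ : ∃ k, g = k + 1 := ⟨g - 1, by omega⟩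
  have hI : (Complex.I) ^ (2 * (k + 1)) = (-1) ^ (k + 1) := by rw [pow_mul, Complex.I_sq]
  rw [mul_pow, mul_pow, hI, show 2 * (k + 1) - 1 = 2 * k + 1 by omega]
  simp
  have : ((2 * (k + 1)).factorial : ℂ) ≠ 0 := by exact_mod_cast Nat.factorial_ne_zero _
  field_simp
  ring

/-- With `g = k + 2`, this is `2 (2g)! / (2g-3)! = 4g(2g-1)(2g-2)`: it turns the denominators of `H`
into the factorial of Euler's formula. -/
lemma bernoulli_factorial_identity (k : ℕ) (x : ℂ) :
    x / (4 * ((k + 2 : ℕ) : ℂ) * (2 * ((k + 2 : ℕ) : ℂ) - 1) * (2 * ((k + 2 : ℕ) : ℂ) - 2)) =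
      x / (2 * ((2 * (k + 2)).factorial : ℂ)) * ((2 * k + 1).factorial : ℂ) := by
  have hf : (2 * (k + 2)).factorial =
      (2 * k + 4) * ((2 * k + 3) * ((2 * k + 2) * (2 * k + 1).factorial)) := by
    rw [show 2 * (k + 2) = 2 * k + 1 + 1 + 1 + 1 by ring]
    simp only [Nat.factorial_succ]
  have h0 : ((2 * k + 1).factorial : ℂ) ≠ 0 := by exact_mod_cast Nat.factorial_ne_zero _
  have h1 : (k : ℂ) + 1 ≠ 0 := by exact_mod_cast Nat.succ_ne_zero k
  have h2 : (k : ℂ) + 2 ≠ 0 := by exact_mod_cast Nat.succ_ne_zero (k + 1)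
  have h3 : 2 * (k : ℂ) + 3 ≠ 0 := by exact_mod_cast Nat.succ_ne_zero (2 * k + 2)
  have e1 : 2 * ((k : ℂ) + 2) - 1 = 2 * k + 3 := by ring
  have e2 : 2 * ((k : ℂ) + 2) - 2 = 2 * (k + 1) := by ring
  have e3 : 2 * (k : ℂ) + 4 = 2 * (k + 2) := by ring
  have e4 : 2 * (k : ℂ) + 2 = 2 * (k + 1) := by ring
  rw [hf]
  push_cast
  rw [e1, e2, e3, e4]
  field_simp
  ring

/-- Differentiation and the Borel transform carry `ε^(2g-1)` to `(2g-1) η^(2g-3) / (2g-3)!`, so `n =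
2g - 3`. The factor `n + 2` is the one produced by `2 + u d/du`. -/
lemma coeff_borelTransform_seriesF (ω : Fin 2 → ℂ) (n : ℕ) :
    (borelTransform (seriesF ω)).coeff n =
      (n + 2) * zetaCoeff ω n * ∑' m : ℕ, 1 / ((m + 1 : ℕ) : ℂ) ^ (n + 2 + 1) := by
  rw [borelTransform, FormalMultilinearSeries.coeff_ofScalars, seriesF,
    PowerSeries.coeff_derivative, seriesH, PowerSeries.coeff_mk, zetaCoeff]
  rcases Nat.even_or_odd n with hn | hn
  · rw [if_neg fun h => Nat.not_odd_iff_even.2 (hn.add even_two) h.1,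
      if_neg (Nat.not_odd_iff_even.2 hn)]
    simp
  · rw [if_pos ⟨hn.add_even even_two, by have := hn.pos; omega⟩, if_pos hn]
    obtain ⟨k, rfl⟩ := hn
    rw [show (2 * k + 1 + 1 + 1 + 1) / 2 = k + 2 by omega,
      show 2 * k + 1 + 2 + 1 = 2 * (k + 2) by ring, tsum_one_div_succ_pow (by omega), coeffH,
      bernoulli_factorial_identity, show 2 * (k + 2) - 2 = 2 * k + 1 + 1 by omega]
    have h0 : ((2 * k + 1).factorial : ℂ) ≠ 0 := by exact_mod_cast Nat.factorial_ne_zero _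
    have h1 : ((2 * (k + 2)).factorial : ℂ) ≠ 0 := by exact_mod_cast Nat.factorial_ne_zero _
    push_cast
    field_simp
    ring

/-- Now `n = 2g - 2`, and the quotient `(2g-3)! / (2g-2)! = 1/n` is the division by `n` in
`periodCoeff`. -/
lemma coeff_borelTransform_seriesK (i : Fin 2) (ω : Fin 2 → ℂ) (n : ℕ) :
    (borelTransform (seriesK i ω)).coeff n =
      periodCoeff i ω n * ∑' m : ℕ, 1 / ((m + 1 : ℕ) : ℂ) ^ (n + 1 + 1) := by
  rw [borelTransform, FormalMultilinearSeries.coeff_ofScalars, seriesK, PowerSeries.coeff_mk,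
    periodCoeff]
  simp only [seriesH, PowerSeries.coeff_mk]
  by_cases hn : Even n ∧ 2 ≤ n
  · have hodd : Odd (n + 1) ∧ 3 ≤ n + 1 := ⟨hn.1.add_one, by omega⟩
    simp only [if_pos hodd, if_pos hn]
    obtain ⟨k, rfl⟩ : ∃ k, n = 2 * k + 2 := by
      obtain ⟨⟨j, hj⟩, h2⟩ := hn
      exact ⟨j - 1, by omega⟩
    rw [show (2 * k + 2 + 1 + 1) / 2 = k + 2 by omega,
      show 2 * k + 2 + 1 + 1 = 2 * (k + 2) by ring, tsum_one_div_succ_pow (by omega)]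
    have hfun : (fun ω' => coeffH (k + 2) ω') = fun ω' =>
        ((bernoulli (2 * (k + 2)) : ℂ) * (2 * Real.pi * Complex.I) ^ (2 * (k + 2)) /
          (2 * ((2 * (k + 2)).factorial : ℂ)) * ((2 * k + 1).factorial : ℂ)) *
          eisensteinG (2 * k + 2) ω' := by
      funext ω'
      rw [coeffH, bernoulli_factorial_identity, show 2 * (k + 2) - 2 = 2 * k + 2 by omega]
      ring
    have h0 : ((2 * k + 1).factorial : ℂ) ≠ 0 := by exact_mod_cast Nat.factorial_ne_zero _
    have h1 : ((2 * (k + 2)).factorial : ℂ) ≠ 0 := by exact_mod_cast Nat.factorial_ne_zero _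
    have h2 : ((2 * k + 2 : ℕ) : ℂ) ≠ 0 := by exact_mod_cast Nat.succ_ne_zero (2 * k + 1)
    rw [hfun, partialω, deriv_const_mul_field, ← partialω, Nat.factorial_succ (2 * k + 1),
      Nat.cast_mul]
    field_simp
  · have hodd : ¬ (Odd (n + 1) ∧ 3 ≤ n + 1) := fun h =>
      hn ⟨by simpa [Nat.odd_add_one] using h.1, by omega⟩
    simp only [if_neg hodd, if_neg hn, partialω]
    simp

lemma hasFPowerSeriesAt_dilations {c : ℂ → ℂ} {N : ℕ} (hN : 1 ≤ N) {γ : ℕ → ℂ}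
    (hγ : ∃ r > 0, ∀ u : ℂ, ‖u‖ < r → HasSum (fun n => γ n * u ^ n) (c u))
    {p : FormalMultilinearSeries ℂ ℂ ℂ}
    (hp : ∀ n, p.coeff n = γ n * ∑' m : ℕ, 1 / ((m + 1 : ℕ) : ℂ) ^ (n + N + 1)) :
    HasFPowerSeriesAt
      (fun η => ∑' m : ℕ, 1 / ((m + 1 : ℕ) : ℂ) ^ (N + 1) * c (η / (m + 1 : ℕ))) p 0 := by
  obtain ⟨r, hr, h⟩ := hγ
  rw [hasFPowerSeriesAt_iff]
  filter_upwards [ball_mem_nhds (0 : ℂ) hr] with η hη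
  rw [zero_add]
  refine (hasSum_taylor_dilations h hN (by simpa using hη)).congr_fun fun n => ?_
  rw [hp, smul_eq_mul, mul_comm]

end EllipticBorel

/-! ### The Borel transforms as sums over dilations -/

open EllipticBorel in
theorem mainTheorem4 (ω : Fin 2 → ℂ) (hω : ω ∈ periodRegion) :
    (0 < (borelTransform (seriesF ω)).radius ∧
      ∃ f : ℂ → ℂ,
        HasFPowerSeriesAt f (borelTransform (seriesF ω)) 0 ∧
        MeromorphicWithPoles f 2 (puncturedLattice ω) ∧
        ConvergesOnCompacts (fun m η => 1 / (m : ℂ) ^ 3 * curlyF ω (η / m)) ∧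
        ∀ η ∉ puncturedLattice ω,
          HasSum (fun m : ℕ => 1 / ((m + 1 : ℕ) : ℂ) ^ 3 * curlyF ω (η / (m + 1 : ℕ))) (f η)) ∧
    ∀ i : Fin 2,
      0 < (borelTransform (seriesK i ω)).radius ∧
      ∃ k : ℂ → ℂ,
        HasFPowerSeriesAt k (borelTransform (seriesK i ω)) 0 ∧
        MeromorphicWithPoles k 1 (latticePart ω i) ∧
        ConvergesOnCompacts (fun m η => 1 / (m : ℂ) ^ 2 * curlyK i ω (η / m)) ∧
        ∀ η ∉ latticePart ω i,
          HasSum (fun m : ℕ => 1 / ((m + 1 : ℕ) : ℂ) ^ 2 * curlyK i ω (η / (m + 1 : ℕ))) (k η) := by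
  refine ⟨?_, fun i => ?_⟩
  · have h0 := zero_notMem_puncturedLattice hω
    have hA : ∀ z ∉ puncturedLattice ω, AnalyticAt ℂ (curlyF ω) z :=
      fun z hz => analyticAt_curlyF hω hz
    have hP : ∀ z ∈ puncturedLattice ω, ∃ p : ℂ → ℂ, AnalyticAt ℂ p z ∧ p z = -z ∧
        ∀ᶠ u in nhdsWithin z {z}ᶜ, curlyF ω u = p u / (u - z) ^ 2 :=
      fun z hz => exists_polar_part_curlyF hω hz
    have hpow := hasFPowerSeriesAt_dilations (N := 2) one_le_two (exists_hasSum_taylor_curlyF hω)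
      (coeff_borelTransform_seriesF ω)
    refine ⟨hpow.radius_pos, _, hpow, ?_, convergesOnCompacts_dilations hA hP one_le_two h0,
      fun η _ => (summable_dilations (hA 0 h0) one_le_two η).hasSum⟩
    refine meromorphicWithPoles_dilations hA hP one_le_two
      (fun z hz h => h0 (neg_eq_zero.1 h ▸ hz)) h0 fun z m hm hz => ⟨?_, by ring⟩
    obtain ⟨a, ha, hza⟩ := hz
    have hm0 : (m : ℂ) ≠ 0 := by exact_mod_cast hm
    refine ⟨m • a, smul_ne_zero hm ha, ?_⟩
    rw [latticePoint_nsmul, ← hza, mul_div_cancel₀ _ hm0]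
  · have h0 := zero_notMem_latticePart hω i
    have hA : ∀ z ∉ latticePart ω i, AnalyticAt ℂ (curlyK i ω) z :=
      fun z hz => analyticAt_curlyK hω i hz
    -- The leading coefficient has to be a function of the point, not of its index; `latticeCoord`
    -- recovers `aᵢ` from the point, and it is homogeneous under integer multiples.
    have hP : ∀ z ∈ latticePart ω i, ∃ p : ℂ → ℂ, AnalyticAt ℂ p z ∧
        p z = -(latticeCoord ω i z : ℂ) ∧
        ∀ᶠ u in nhdsWithin z {z}ᶜ, curlyK i ω u = p u / (u - z) ^ 1 := by
      rintro z ⟨a, ha, rfl⟩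
      rw [latticeCoord_latticePoint hω]
      exact exists_polar_part_curlyK hω i fun h => ha (by simp [h])
    have hpow := hasFPowerSeriesAt_dilations (N := 1) le_rfl (exists_hasSum_taylor_curlyK hω i)
      (coeff_borelTransform_seriesK i ω)
    refine ⟨hpow.radius_pos, _, hpow, ?_, convergesOnCompacts_dilations hA hP le_rfl h0,
      fun η _ => (summable_dilations (hA 0 h0) le_rfl η).hasSum⟩
    refine meromorphicWithPoles_dilations hA hP le_rfl ?_ h0 ?_
    · rintro z ⟨a, ha, rfl⟩ h
      rw [latticeCoord_latticePoint hω] at h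
      exact ha (by simpa using h)
    · rintro z m hm ⟨a, ha, hza⟩
      have hm0 : (m : ℂ) ≠ 0 := by exact_mod_cast hm
      have hz : z = latticePoint ω (m • a) := by
        rw [latticePoint_nsmul, ← hza, mul_div_cancel₀ _ hm0]
      refine ⟨⟨m • a, ?_, hz⟩, ?_⟩
      · simpa using ⟨hm, ha⟩
      · rw [hza, hz, latticeCoord_latticePoint hω, latticeCoord_latticePoint hω]
        simp only [Pi.smul_apply, nsmul_eq_mul, Int.cast_mul, Int.cast_natCast]
        field_simp
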